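/- Let $P=\langle X\mid R\rangle$ be a finite group presentation, i.e. $X$ is a finite set and $R$ a finite set of group words over $X$. An \emph{annular diagram} over $P$ is a finite connected graph drawn on the oriented sphere, with edges labeled by letters of $X^{\pm1}$ (reversing an edge inverts its label), together with two distinct faces, called holes, such that the contour of every other face, called a \emph{cell}, has as its label, read from a suitable vertex, a word of $R^{\pm1}$. The contours $p$ and $p'$ of the two holes are the boundary components; their labels are cyclic words. The diagram is \emph{proper} if $p$ and $p'$ are disjoint simple closed curves, so that it tessellates an actual annulus; in general the contours may touch themselves or each other. The \emph{area} of a diagram is the number of its cells. A diagram is \emph{minimal} if it has the smallest area among all annular diagrams over $P$ whose inner and outer boundary components have the same labels as its own; a proper diagram is also called minimal if it has the smallest area among all proper annular diagrams over $P$ with the same boundary labels. Then there is a constant $C>0$, depending only on $P$, such that for every annular diagram $\Delta$ over $P$ that is minimal in either of these two senses, and for every shortest path $x$ in the graph of $\Delta$ connecting a vertex of $p$ with a vertex of $p'$, the area of $\Delta$ is at least $C\,|x|\log|x|$. Here $|x|$ is the number of edges of $x$, and $0\log 0=0$. -/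

import Mathlib

/-- A group word over the alphabet `X`: the letter `(a, true)` is `a`, the letter `(a, false)` is
`a⁻¹`. Words are not reduced. The formal inverse of a word is `FreeGroup.invRev`. -/
abbrev GroupWord (X : Type*) : Type _ := List (X × Bool)

/-- A finite connected graph (loops and multiple edges allowed) drawn on the oriented sphere, with at
least one edge, up to isotopy, given by its rotation system.

A dart is an edge with a direction; `rev` reverses the direction. The map `rot` sends a dart `d`
to the counterclockwise next dart with the same initial vertex. -/
structure SphereMap where
  /-- The oriented edges. -/
  Dart : Type
  finite_dart : Finite Dart
  nonempty_dart : Nonempty Dart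
  /-- The same edge with the opposite direction. -/
  rev : Equiv.Perm Dart
  rev_rev : ∀ d, rev (rev d) = d
  rev_ne : ∀ d, rev d ≠ d
  /-- Counterclockwise rotation about the initial vertex. -/
  rot : Equiv.Perm Dart
  /-- The graph is connected. -/
  connected : ∀ d e : Dart, ∃ g ∈ Subgroup.closure {rev, rot}, g d = e
  /-- Euler's formula `V + F = E + 2`: the surface carrying the graph is the sphere. The vertices,
  edges and faces are the orbits of `rot`, of `rev`, and of the permutation sending a dart to the
  next one along the face to its left. -/
  euler :
    Nat.card (Quotient (Equiv.Perm.SameCycle.setoid rot)) +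
      Nat.card (Quotient (Equiv.Perm.SameCycle.setoid (rot⁻¹ * rev))) =
    Nat.card (Quotient (Equiv.Perm.SameCycle.setoid rev)) + 2

namespace SphereMap

variable (M : SphereMap)

/-- The dart following `d` on the contour of the face to the left of `d`. -/
def next : Equiv.Perm M.Dart := M.rot⁻¹ * M.rev

/-- The vertices of the graph. -/
def Vertex : Type := Quotient (Equiv.Perm.SameCycle.setoid M.rot)

/-- The faces: the connected components of the complement of the graph in the sphere. -/
def Face : Type := Quotient (Equiv.Perm.SameCycle.setoid M.next)

/-- The initial vertex of an oriented edge. -/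
def tail (d : M.Dart) : M.Vertex := Quotient.mk _ d

/-- The terminal vertex of an oriented edge. -/
def head (d : M.Dart) : M.Vertex := M.tail (M.rev d)

/-- The face to the left of an oriented edge. -/
def face (d : M.Dart) : M.Face := Quotient.mk _ d

/-- The vertex `v` lies on the contour of the face `f`. -/
def OnContour (v : M.Vertex) (f : M.Face) : Prop := ∃ d, M.tail d = v ∧ M.face d = f

/-- `M.IsPath v w x`: the sequence `x` of oriented edges is a path from `v` to `w`. -/
def IsPath : M.Vertex → M.Vertex → List M.Dart → Prop
  | v, w, [] => v = w
  | v, w, d :: x => M.tail d = v ∧ IsPath (M.head d) w x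

end SphereMap

/-- An annular diagram over the presentation `⟨X | R⟩`: a labelled map on the sphere with two
distinct faces, the holes, removed; all remaining faces are cells, and the label of the contour of
a cell is, from a suitable starting vertex, a word of `R` or the inverse of one. The contours of the
holes may touch themselves or each other. -/
structure AnnularDiagram {X : Type*} (R : Set (GroupWord X)) extends SphereMap where
  /-- The label of an oriented edge. -/
  label : Dart → X × Bool
  label_rev : ∀ d, label (rev d) = ((label d).1, !(label d).2)
  /-- The hole bounded by the inner boundary component `p`. -/
  inner : toSphereMap.Face
  /-- The hole bounded by the outer boundary component `p'`. -/
  outer : toSphereMap.Face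
  inner_ne_outer : inner ≠ outer
  cell_label : ∀ d, toSphereMap.face d ≠ inner → toSphereMap.face d ≠ outer →
    ∃ r ∈ R,
      (Function.periodicOrbit toSphereMap.next d).map label = (r : Cycle (X × Bool)) ∨
      (Function.periodicOrbit toSphereMap.next d).map label =
        (FreeGroup.invRev r : Cycle (X × Bool))

namespace AnnularDiagram

variable {X : Type*} {R : Set (GroupWord X)} (Δ : AnnularDiagram R)

/-- The area: the number of cells. -/
noncomputable def area : ℕ := Nat.card {f : Δ.Face // f ≠ Δ.inner ∧ f ≠ Δ.outer}

/-- The cyclic word read along the contour of the face to the left of `d`. -/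
noncomputable def contourLabel (d : Δ.Dart) : Cycle (X × Bool) :=
  (Function.periodicOrbit Δ.next d).map Δ.label

/-- The inner boundary components of the two diagrams have the same label, and so do the outer
ones. Boundary labels are cyclic words, read with the hole on the left. -/
def SameBoundaryLabels (Δ' : AnnularDiagram R) : Prop :=
  (∀ d d', Δ.face d = Δ.inner → Δ'.face d' = Δ'.inner → Δ.contourLabel d = Δ'.contourLabel d') ∧
  (∀ d d', Δ.face d = Δ.outer → Δ'.face d' = Δ'.outer → Δ.contourLabel d = Δ'.contourLabel d')

/-- The two boundary components are disjoint simple closed curves, so that the diagram tessellates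
an actual annulus. -/
def IsProper : Prop :=
  (∀ d e, Δ.face d = Δ.inner → Δ.face e = Δ.inner → Δ.tail d = Δ.tail e → d = e) ∧
  (∀ d e, Δ.face d = Δ.outer → Δ.face e = Δ.outer → Δ.tail d = Δ.tail e → d = e) ∧
  ∀ v, ¬ (Δ.OnContour v Δ.inner ∧ Δ.OnContour v Δ.outer)

/-- The diagram has the smallest area among all annular diagrams over the same presentation with
the same boundary labels. -/
def IsMinimal : Prop :=
  ∀ Δ' : AnnularDiagram R, Δ.SameBoundaryLabels Δ' → Δ.area ≤ Δ'.area

/-- The diagram tessellates an actual annulus, and it has the smallest area among all such diagrams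
over the same presentation with the same boundary labels. -/
def IsMinimalProper : Prop :=
  Δ.IsProper ∧
    ∀ Δ' : AnnularDiagram R, Δ'.IsProper → Δ.SameBoundaryLabels Δ' → Δ.area ≤ Δ'.area

/-- The path `x` connects the inner boundary component with the outer one. -/
def Connects (x : List Δ.Dart) : Prop :=
  ∃ v w, Δ.OnContour v Δ.inner ∧ Δ.OnContour w Δ.outer ∧ Δ.IsPath v w x

/-- `x` is a shortest path connecting the two boundary components. -/
def IsShortestConnecting (x : List Δ.Dart) : Prop :=
  Δ.Connects x ∧ ∀ y, Δ.Connects y → x.length ≤ y.length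

end AnnularDiagram

/-!
Let `x` be a shortest path joining the boundary components. For `i < |x|`, the vertices that can be
reached from the inner hole without coming within distance `i` of the outer one are bounded by a
closed curve that crosses only cells. The word read along this curve records, for every crossed
edge, the contour of the cell entered, the place where the curve leaves it, and `i` modulo a bound
`L` for the length of the relators; so its letters come from a finite alphabet depending only on
the presentation. If two of these words agreed, the part of the diagram between the two curves could
be cut out and the remaining parts glued along them, which would give a diagram of smaller area with
the same boundary labels. So the `|x|` words of a minimal diagram are distinct, and their total
length is at least of the order of `|x| log |x|`. On the other hand the curves cross distinct edges
and a cell has at most `L` edges, so that the total length is at most `L` times the area.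

The topology of the sphere enters through Euler's formula, which is equivalent to the vanishing of
the first cohomology of the map. This gives that a curve that bounds a connected set with connected
complement is a single closed curve, and that gluing two planar pieces gives a planar map.
-/

/-! ### Linear algebra of functions on a finite set -/

open Module Equiv Equiv.Perm

section FiniteSet

variable {α β : Type*} {π : Perm α}

theorem eq_of_sameCycle {h : α → β} (hh : ∀ a, h (π a) = h a) {a b : α} (hab : π.SameCycle a b) :
    h a = h b := by
  obtain ⟨n, rfl⟩ := hab
  induction n with
  | zero => rfl
  | succ n ih => rw [ih, add_comm, zpow_one_add, mul_apply, hh]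
  | pred n ih => rw [ih, ← hh ((π ^ (-(n : ℤ) - 1)) a), ← mul_apply, ← zpow_one_add, add_sub_cancel]

/-- The functions constant on the cycles of a permutation. For the three permutations of a
rotation system these are the functions on vertices, on edges and on faces. -/
def invariantFunctions (π : Perm α) : Submodule ℝ (α → ℝ) where
  carrier := {h | ∀ a, h (π a) = h a}
  add_mem' hf hg a := by simp [hf a, hg a]
  zero_mem' _ := rfl
  smul_mem' c f hf a := by simp [hf a]

theorem mem_invariantFunctions {h : α → ℝ} : h ∈ invariantFunctions π ↔ ∀ a, h (π a) = h a :=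
  Iff.rfl

theorem finrank_invariantFunctions [Finite α] (π : Perm α) :
    finrank ℝ (invariantFunctions π) = Nat.card (Quotient (SameCycle.setoid π)) := by
  let ofQuotient : (Quotient (SameCycle.setoid π) → ℝ) ≃ₗ[ℝ] invariantFunctions π :=
    { toFun h := ⟨fun a => h (Quotient.mk _ a), fun a => congrArg h <|
        Quotient.sound (sameCycle_apply_left.2 (SameCycle.refl π a))⟩
      map_add' _ _ := rfl
      map_smul' _ _ := rfl
      invFun h := Quotient.lift h.1 fun _ _ hab => eq_of_sameCycle h.2 hab
      left_inv h := by ext ⟨a⟩; rfl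
      right_inv _ := rfl }
  have := Fintype.ofFinite (Quotient (SameCycle.setoid π))
  rw [← ofQuotient.finrank_eq, finrank_fintype_fun_eq_card, Nat.card_eq_fintype_card]

variable [Fintype α]

/-- The functions orthogonal to a space of functions, for the dot product. -/
def dotOrthogonal (K : Submodule ℝ (α → ℝ)) : Submodule ℝ (α → ℝ) :=
  LinearMap.BilinForm.orthogonal (dotProductBilin ℝ ℝ) K

theorem mem_dotOrthogonal {K : Submodule ℝ (α → ℝ)} {f : α → ℝ} :
    f ∈ dotOrthogonal K ↔ ∀ h ∈ K, h ⬝ᵥ f = 0 :=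
  Iff.rfl

theorem dotProductBilin_nondegenerate :
    LinearMap.BilinForm.Nondegenerate (dotProductBilin ℝ ℝ (m := α) (A := ℝ)) :=
  ⟨fun f hf => dotProduct_eq_zero f hf,
    fun f hf => dotProduct_eq_zero f fun h => (dotProduct_comm f h).trans (hf h)⟩

theorem finrank_dotOrthogonal (K : Submodule ℝ (α → ℝ)) :
    finrank ℝ (dotOrthogonal K) = Fintype.card α - finrank ℝ K := by
  rw [dotOrthogonal, LinearMap.BilinForm.finrank_orthogonal dotProductBilin_nondegenerate,
    finrank_fintype_fun_eq_card]

theorem dotOrthogonal_dotOrthogonal (K : Submodule ℝ (α → ℝ)) :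
    dotOrthogonal (dotOrthogonal K) = K :=
  LinearMap.BilinForm.orthogonal_orthogonal dotProductBilin_nondegenerate
    (fun f h hfh => (dotProduct_comm h f).trans hfh) K

theorem dotOrthogonal_sup (K L : Submodule ℝ (α → ℝ)) :
    dotOrthogonal (K ⊔ L) = dotOrthogonal K ⊓ dotOrthogonal L := by
  ext f
  refine ⟨fun hf => ⟨fun h hh => hf h (Submodule.mem_sup_left hh),
    fun h hh => hf h (Submodule.mem_sup_right hh)⟩, fun ⟨hK, hL⟩ h hh => ?_⟩
  obtain ⟨k, hk, l, hl, rfl⟩ := Submodule.mem_sup.1 hh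
  exact (add_dotProduct k l f).trans (by simp [mem_dotOrthogonal.1 hK k hk,
    mem_dotOrthogonal.1 hL l hl])

theorem mem_of_forall_dotProduct_eq_zero {K : Submodule ℝ (α → ℝ)} {f : α → ℝ}
    (hf : ∀ y, (∀ k ∈ K, k ⬝ᵥ y = 0) → y ⬝ᵥ f = 0) : f ∈ K := by
  rw [← dotOrthogonal_dotOrthogonal K]
  exact hf

end FiniteSet

/-! ### Rotation systems -/

/-- A finite graph, not necessarily connected, drawn on an oriented closed surface, with the
conventions of `SphereMap`. -/
structure RotationSystem (D : Type*) where
  /-- The same edge with the opposite direction. -/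
  rev : Perm D
  /-- Counterclockwise rotation about the initial vertex. -/
  rot : Perm D
  rev_rev : ∀ d, rev (rev d) = d
  rev_ne : ∀ d, rev d ≠ d

namespace RotationSystem

variable {D : Type*} (G : RotationSystem D)

/-- The dart following `d` on the contour of the face to the left of `d`. -/
def next : Perm D := G.rot⁻¹ * G.rev

theorem rot_next (d : D) : G.rot (G.next d) = G.rev d := by simp [next]

theorem next_rev_rot (d : D) : G.next (G.rev (G.rot d)) = d := by simp [next, G.rev_rev]

/-- The set of darts `S` consists of all darts leaving some set of vertices. -/
def Invariant (S : Set D) : Prop := ∀ d, G.rot d ∈ S ↔ d ∈ S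

/-- `T` is a set of vertices, given by the darts leaving them, that contains both ends or neither
end of every edge of the subgraph spanned by the vertices in `S`. -/
def Saturated (S T : Set D) : Prop :=
  G.Invariant T ∧ ∀ d ∈ S, G.rev d ∈ S → (G.rev d ∈ T ↔ d ∈ T)

/-- The subgraph spanned by the vertices with darts in `S` is connected. -/
def Conn (S : Set D) : Prop := ∀ T, G.Saturated S T → S ⊆ T ∨ S ⊆ Tᶜ

variable {G} {S T : Set D}

theorem Invariant.compl (h : G.Invariant S) : G.Invariant Sᶜ := fun d => not_congr (h d)

theorem Invariant.next_mem_iff (h : G.Invariant S) (d : D) : G.next d ∈ S ↔ G.rev d ∈ S := by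
  rw [← h (G.next d), rot_next]

theorem Invariant.mem_iff_of_sameCycle (h : G.Invariant S) {a b : D} (hab : G.rot.SameCycle a b) :
    a ∈ S ↔ b ∈ S :=
  iff_of_eq (eq_of_sameCycle (h := (· ∈ S)) (fun d => propext (h d)) hab)

theorem Saturated.compl (h : G.Saturated S T) : G.Saturated S Tᶜ :=
  ⟨h.1.compl, fun d hd hd' => not_congr (h.2 d hd hd')⟩

theorem conn_of_forall_saturated (o : D) (h : ∀ T, G.Saturated S T → o ∈ T → S ⊆ T) : G.Conn S :=
  fun T hT => (em (o ∈ T)).imp (h T hT) (h Tᶜ hT.compl)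

theorem Conn.subset (hS : G.Conn S) (hT : G.Saturated S T) {o : D} (hoS : o ∈ S) (hoT : o ∈ T) :
    S ⊆ T :=
  (hS T hT).resolve_right fun h => h hoS hoT

theorem Conn.eq_of_invariant (hS : G.Conn S) {α : Type*} {g : D → α}
    (hrot : ∀ d, g (G.rot d) = g d) (hrev : ∀ d ∈ S, G.rev d ∈ S → g (G.rev d) = g d)
    {a b : D} (ha : a ∈ S) (hb : b ∈ S) : g a = g b :=
  hS.subset (T := {d | g d = g b})
    ⟨fun d => by simp [hrot], fun d h1 h2 => by simp [hrev d h1 h2]⟩ hb rfl ha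

/-! ### Planarity and the Euler formula -/

variable (G)

/-- The coboundary of a function on vertices or on faces: its increment along every dart, from the
tail to the head or from the left to the right. -/
def grad : (D → ℝ) →ₗ[ℝ] D → ℝ := LinearMap.funLeft ℝ ℝ G.rev - LinearMap.id

@[simp] theorem grad_apply (g : D → ℝ) (d : D) : G.grad g d = g (G.rev d) - g d := rfl

/-- The one-cochains: the functions that change sign when a dart is reversed. -/
def antisymmetric : Submodule ℝ (D → ℝ) where
  carrier := {f | ∀ d, f (G.rev d) = -f d}
  add_mem' hf hg d := by simp [hf d, hg d, add_comm]
  zero_mem' _ := by simp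
  smul_mem' c f hf d := by simp [hf d]

/-- Planarity, as the vanishing of the first cohomology of the surface: an antisymmetric function
whose sum around every face vanishes is the coboundary of a function on vertices. -/
def IsPlanar [Fintype D] : Prop :=
  G.antisymmetric ⊓ dotOrthogonal (invariantFunctions G.next) ≤
    (invariantFunctions G.rot).map G.grad

theorem grad_mem_antisymmetric (g : D → ℝ) : G.grad g ∈ G.antisymmetric := fun d => by
  simp [G.rev_rev]

variable {G}

theorem grad_of_antisymmetric {f : D → ℝ} (hf : f ∈ G.antisymmetric) :
    G.grad f = (-2 : ℝ) • f := by
  ext d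
  simp [hf d]
  ring

theorem grad_dotProduct [Fintype D] (f h : D → ℝ) : G.grad f ⬝ᵥ h = f ⬝ᵥ G.grad h := by
  have reindex : ∑ d, f (G.rev d) * h d = ∑ d, f d * h (G.rev d) := by
    rw [← Equiv.sum_comp G.rev fun d => f d * h (G.rev d)]
    simp only [G.rev_rev]
  simp only [dotProduct, grad_apply, sub_mul, mul_sub, Finset.sum_sub_distrib, reindex]

theorem dotProduct_grad_eq_zero [Fintype D] {g h : D → ℝ} (hg : g ∈ invariantFunctions G.rot)
    (hh : h ∈ invariantFunctions G.next) : h ⬝ᵥ G.grad g = 0 := by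
  have reindex : ∑ d, h d * g (G.rev d) = ∑ d, h d * g d := by
    rw [← Equiv.sum_comp G.next fun d => h d * g d]
    refine Finset.sum_congr rfl fun d _ => ?_
    rw [hh d, ← hg (G.next d), rot_next]
  simp only [dotProduct, grad_apply, mul_sub, Finset.sum_sub_distrib, reindex, sub_self]

theorem antisymmetric_eq_dotOrthogonal [Fintype D] (G : RotationSystem D) :
    G.antisymmetric = dotOrthogonal (invariantFunctions G.rev) := by
  ext f
  refine ⟨fun hf h hh => ?_, fun hf => ?_⟩
  · have := grad_dotProduct (G := G) h f
    rw [grad_of_antisymmetric hf, show G.grad h = 0 from funext fun d => sub_eq_zero.2 (hh d),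
      zero_dotProduct, dotProduct_smul, smul_eq_mul, zero_eq_mul] at this
    exact this.resolve_left (by norm_num)
  · have hsymm : f + f ∘ G.rev ∈ invariantFunctions G.rev := fun d => by
      simp [G.rev_rev, add_comm]
    have hortho : (f + f ∘ G.rev) ⬝ᵥ f = 0 := mem_dotOrthogonal.1 hf _ hsymm
    have hself : (f + f ∘ G.rev) ⬝ᵥ (f + f ∘ G.rev) = 0 := by
      have hgrad : (f + f ∘ G.rev) ⬝ᵥ G.grad f = 0 := by
        rw [← grad_dotProduct, show G.grad (f + f ∘ G.rev) = 0 from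
          funext fun d => sub_eq_zero.2 (hsymm d), zero_dotProduct]
      have hsplit : f + f ∘ G.rev = (2 : ℝ) • f + G.grad f := by
        ext d
        simp
        ring
      nth_rw 2 [hsplit]
      rw [dotProduct_add, dotProduct_smul, hortho, hgrad, smul_zero, add_zero]
    intro d
    have := congrFun (dotProduct_self_eq_zero.1 hself) d
    simp only [Pi.add_apply, Function.comp_apply, Pi.zero_apply] at this
    linarith

theorem sameCycle_rev_iff {a b : D} : G.rev.SameCycle a b ↔ b = a ∨ b = G.rev a := by
  constructor
  · rintro ⟨n, rfl⟩
    have sq_eq_one : G.rev ^ (2 : ℤ) = 1 := by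
      ext d
      simp [zpow_ofNat, sq, G.rev_rev]
    rcases Int.even_or_odd' n with ⟨k, rfl | rfl⟩
    · left; simp [zpow_mul, sq_eq_one]
    · right; simp [zpow_add, zpow_mul, sq_eq_one]
  · rintro (rfl | rfl)
    · exact SameCycle.refl _ _
    · exact ⟨1, rfl⟩

theorem exists_orientation (G : RotationSystem D) :
    ∃ s ∈ G.antisymmetric, ∀ d, s d * s d = 1 := by
  classical
  let chosen : D → D := fun d => (Quotient.mk (SameCycle.setoid G.rev) d).out
  have chosen_eq (d : D) : chosen d = d ∨ chosen d = G.rev d :=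
    sameCycle_rev_iff.1 (Quotient.mk_out (s := SameCycle.setoid G.rev) d).symm
  have chosen_rev (d : D) : chosen (G.rev d) = chosen d :=
    congrArg Quotient.out (Quotient.sound (sameCycle_rev_iff.2 (Or.inr (G.rev_rev d).symm)))
  refine ⟨fun d => if chosen d = d then 1 else -1, fun d => ?_, fun d => by
    dsimp only
    split_ifs <;> simp⟩
  rcases chosen_eq d with h | h <;> simp [chosen_rev, h, G.rev_ne, (G.rev_ne d).symm]

theorem finrank_antisymmetric_eq (G : RotationSystem D) :
    finrank ℝ G.antisymmetric = finrank ℝ (invariantFunctions G.rev) := by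
  obtain ⟨s, hs, hss⟩ := G.exists_orientation
  have mul_mul_self (f : D → ℝ) : s * (s * f) = f := by
    ext d
    simp [← mul_assoc, hss d]
  let mulOrientation : G.antisymmetric ≃ₗ[ℝ] invariantFunctions G.rev :=
    { toFun f := ⟨s * f.1, fun d => by simp [hs d, f.2 d]⟩
      map_add' f h := Subtype.ext (mul_add s f.1 h.1)
      map_smul' c f := Subtype.ext (mul_smul_comm c s f.1)
      invFun h := ⟨s * h.1, fun d => by simp [hs d, h.2 d]⟩
      left_inv f := Subtype.ext (mul_mul_self f.1)
      right_inv h := Subtype.ext (mul_mul_self h.1) }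
  exact mulOrientation.finrank_eq

theorem two_mul_card_edges [Fintype D] (G : RotationSystem D) :
    2 * finrank ℝ (invariantFunctions G.rev) = Fintype.card D := by
  have antisymm := G.finrank_antisymmetric_eq
  rw [antisymmetric_eq_dotOrthogonal, finrank_dotOrthogonal] at antisymm
  have le := (invariantFunctions G.rev).finrank_le
  rw [finrank_fintype_fun_eq_card] at le
  omega

theorem invariantFunctions_rev_inf_next (G : RotationSystem D) :
    invariantFunctions G.rev ⊓ invariantFunctions G.next =
      invariantFunctions G.rev ⊓ invariantFunctions G.rot := by
  ext h
  refine and_congr_right fun hrev => ⟨fun hnext d => ?_, fun hrot d => ?_⟩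
  · rw [← hrev, ← hnext, next_rev_rot]
  · rw [← hrot, rot_next, hrev]

theorem finrank_invariantFunctions_rev_inf_rot [Nonempty D] (hc : G.Conn Set.univ) :
    finrank ℝ ↥(invariantFunctions G.rev ⊓ invariantFunctions G.rot) = 1 := by
  have eq_span : invariantFunctions G.rev ⊓ invariantFunctions G.rot =
      Submodule.span ℝ {(1 : D → ℝ)} := by
    refine le_antisymm (fun h hh => ?_) (by simp [Submodule.span_le, mem_invariantFunctions])
    obtain ⟨o⟩ := ‹Nonempty D›
    refine Submodule.mem_span_singleton.2 ⟨h o, funext fun d => ?_⟩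
    simpa using hc.eq_of_invariant hh.2 (fun d _ _ => hh.1 d) (Set.mem_univ o) (Set.mem_univ d)
  rw [eq_span, finrank_span_singleton one_ne_zero]

theorem finrank_map_grad_add_one [Finite D] [Nonempty D] (hc : G.Conn Set.univ) :
    finrank ℝ ((invariantFunctions G.rot).map G.grad) + 1 =
      finrank ℝ (invariantFunctions G.rot) := by
  have ker_grad : G.grad.ker = invariantFunctions G.rev := by
    ext h
    simp [funext_iff, sub_eq_zero, mem_invariantFunctions]
  have rank_nullity := (G.grad.domRestrict (invariantFunctions G.rot)).finrank_range_add_finrank_ker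
  rwa [LinearMap.range_domRestrict, LinearMap.ker_domRestrict,
    ← Submodule.finrank_map_subtype_eq, Submodule.map_comap_subtype, ker_grad,
    inf_comm, finrank_invariantFunctions_rev_inf_rot hc] at rank_nullity

theorem map_grad_le [Fintype D] (G : RotationSystem D) :
    (invariantFunctions G.rot).map G.grad ≤
      G.antisymmetric ⊓ dotOrthogonal (invariantFunctions G.next) := by
  rintro _ ⟨g, hg, rfl⟩
  exact ⟨G.grad_mem_antisymmetric g, fun h hh => dotProduct_grad_eq_zero hg hh⟩

theorem euler_iff_isPlanar [Fintype D] [Nonempty D] (hc : G.Conn Set.univ) :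
    Nat.card (Quotient (SameCycle.setoid G.rot)) + Nat.card (Quotient (SameCycle.setoid G.next)) =
      Nat.card (Quotient (SameCycle.setoid G.rev)) + 2 ↔ G.IsPlanar := by
  simp only [← finrank_invariantFunctions]
  have card_D := G.two_mul_card_edges
  have vertices := finrank_map_grad_add_one hc
  have edges_faces := Submodule.finrank_sup_add_finrank_inf_eq
    (invariantFunctions G.rev) (invariantFunctions G.next)
  rw [invariantFunctions_rev_inf_next, finrank_invariantFunctions_rev_inf_rot hc] at edges_faces
  have sup_le := (invariantFunctions G.rev ⊔ invariantFunctions G.next).finrank_le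
  rw [finrank_fintype_fun_eq_card] at sup_le
  have cocycles : finrank ℝ ↥(G.antisymmetric ⊓ dotOrthogonal (invariantFunctions G.next)) =
      Fintype.card D - finrank ℝ ↥(invariantFunctions G.rev ⊔ invariantFunctions G.next) := by
    rw [antisymmetric_eq_dotOrthogonal, ← dotOrthogonal_sup, finrank_dotOrthogonal]
  constructor
  · intro euler
    exact (Submodule.eq_of_le_of_finrank_eq G.map_grad_le (by omega)).ge
  · intro planar
    rw [le_antisymm planar G.map_grad_le] at cocycles
    omega

theorem IsPlanar.dual [Fintype D] (hG : G.IsPlanar) :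
    G.antisymmetric ⊓ dotOrthogonal (invariantFunctions G.rot) ≤
      (invariantFunctions G.next).map G.grad := by
  rintro z ⟨hz, hzrot⟩
  refine mem_of_forall_dotProduct_eq_zero fun y hy => ?_
  obtain ⟨g, hg, hgy⟩ := hG ⟨G.grad_mem_antisymmetric y, fun h hh =>
    (grad_dotProduct h y).symm.trans (hy _ ⟨h, hh, rfl⟩)⟩
  have pairing : (-2 : ℝ) • (y ⬝ᵥ z) = (-2 : ℝ) • (g ⬝ᵥ z) := by
    rw [← dotProduct_smul, ← dotProduct_smul, ← grad_of_antisymmetric hz, ← grad_dotProduct,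
      ← grad_dotProduct, hgy]
  rw [(smul_right_injective ℝ (by norm_num : (-2 : ℝ) ≠ 0)) pairing]
  exact hzrot g hg

end RotationSystem

/-! ### Bonds -/

section Cycles

variable {α : Type*} {π : Perm α}

theorem sameCycle_iterate (π : Perm α) (n : ℕ) (a : α) : π.SameCycle a (π^[n] a) :=
  ⟨n, by simp [iterate_eq_pow]⟩

theorem exists_iterate_eq_of_sameCycle [Finite α] {a b : α} (h : π.SameCycle a b) :
    ∃ n < Function.minimalPeriod π a, π^[n] a = b := by
  obtain ⟨n, -, rfl⟩ := h.exists_pow_eq'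
  exact ⟨n % Function.minimalPeriod π a, Nat.mod_lt _
    (Function.minimalPeriod_pos_of_mem_periodicPts (π.injective.mem_periodicPts a)),
    by rw [Function.iterate_mod_minimalPeriod_eq, iterate_eq_pow]⟩

theorem sign_of_forall_sameCycle [Fintype α] [DecidableEq α] [Nontrivial α]
    (h : ∀ a b, π.SameCycle a b) : π.sign = -(-1) ^ Fintype.card α := by
  have moves (a : α) : π a ≠ a := fun ha =>
    let ⟨b, hb⟩ := exists_ne a
    hb ((h a b).eq_of_left ha).symm
  obtain ⟨o⟩ : Nonempty α := inferInstance
  have cycle : π.IsCycle := ⟨o, moves o, fun b _ => h o b⟩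
  rw [cycle.sign, show π.support = Finset.univ by ext a; simp [moves a], Finset.card_univ]

theorem eq_of_forall_sameCycle_mul_swap [Finite α] [DecidableEq α] {a b : α}
    (h : ∀ x y, π.SameCycle x y) (hswap : ∀ x y, (π * swap a b).SameCycle x y) : a = b := by
  by_contra hab
  have := Fintype.ofFinite α
  have := nontrivial_of_ne a b hab
  have := (sign_of_forall_sameCycle hswap).trans (sign_of_forall_sameCycle h).symm
  rw [Perm.sign_mul, sign_swap hab, mul_neg, mul_one] at this
  exact neg_units_ne_self _ this

end Cycles

namespace RotationSystem

variable {D : Type*} (G : RotationSystem D)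

/-- A set of vertices such that it and its complement span connected subgraphs, so that the edges
between the two form a minimal cut: in the plane, these are the edges crossed by a simple closed
curve. -/
structure IsCut (S : Set D) : Prop where
  invariant : G.Invariant S
  conn : G.Conn S
  conn_compl : G.Conn Sᶜ

/-- The darts leaving the set of vertices `S`. -/
def bond (S : Set D) : Set D := {d | d ∈ S ∧ G.rev d ∉ S}

/-- The number of darts outside `S` that follow `d` on its face contour before it returns to `S`. -/
noncomputable def run (S : Set D) (d : D) : ℕ := sInf {t | G.next^[t + 1] d ∈ S}

/-- The dart leaving `S` by which the face contour leaving `S` along `d` returns, reversed. -/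
noncomputable def turn (S : Set D) (d : D) : D := G.rev (G.next^[G.run S d] d)

variable {G} {S : Set D} {a b d : D}

theorem iterate_notMem_of_le_run {s : ℕ} (hs : 1 ≤ s) (hsr : s ≤ G.run S d) :
    G.next^[s] d ∉ S := by
  have := Nat.notMem_of_lt_sInf (s := {t | G.next^[t + 1] d ∈ S}) (Nat.sub_one_lt_of_le hs hsr)
  rwa [Set.mem_ofPred_eq, Nat.sub_add_cancel hs] at this

theorem rev_turn (d : D) : G.rev (G.turn S d) = G.next^[G.run S d] d := G.rev_rev _

theorem sameCycle_rev_turn (S : Set D) (d : D) : G.next.SameCycle d (G.rev (G.turn S d)) := by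
  rw [rev_turn]
  exact sameCycle_iterate _ _ _

theorem injOn_turn : Set.InjOn (G.turn S) (G.bond S) := by
  intro a ha b hb hab
  wlog hle : G.run S a ≤ G.run S b generalizing a b
  · exact (this hb ha hab.symm (le_of_not_ge hle)).symm
  have iterate_eq : G.next^[G.run S b - G.run S a] b = a := by
    refine (G.next.injective.iterate (G.run S a)) ?_
    rw [← Function.iterate_add_apply, Nat.add_sub_cancel' hle]
    exact (G.rev.injective hab).symm
  rcases Nat.eq_zero_or_pos (G.run S b - G.run S a) with h0 | hpos
  · rwa [h0, eq_comm] at iterate_eq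
  · refine absurd ha.1 ?_
    have := iterate_notMem_of_le_run hpos (Nat.sub_le (G.run S b) (G.run S a))
    rwa [iterate_eq] at this

section Finite

variable [Finite D]

theorem minimalPeriod_next_pos (d : D) : 0 < Function.minimalPeriod G.next d :=
  Function.minimalPeriod_pos_of_mem_periodicPts (G.next.injective.mem_periodicPts d)

theorem iterate_run_add_one_mem (hd : d ∈ S) : G.next^[G.run S d + 1] d ∈ S := by
  refine Nat.sInf_mem (s := {t | G.next^[t + 1] d ∈ S})
    ⟨Function.minimalPeriod G.next d - 1, ?_⟩
  rwa [Set.mem_ofPred_eq, Nat.sub_add_cancel (minimalPeriod_next_pos d),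
    Function.iterate_minimalPeriod]

theorem run_lt (hd : d ∈ S) : G.run S d < Function.minimalPeriod G.next d := by
  by_contra! h
  refine iterate_notMem_of_le_run (minimalPeriod_next_pos d) h ?_
  rwa [Function.iterate_minimalPeriod]

theorem Invariant.run_pos (hS : G.Invariant S) (hd : d ∈ G.bond S) : 1 ≤ G.run S d := by
  by_contra! h
  have hmem := iterate_run_add_one_mem (G := G) hd.1
  rw [Nat.lt_one_iff.1 h] at hmem
  exact hd.2 ((hS.next_mem_iff d).1 hmem)

theorem Invariant.turn_mem (hS : G.Invariant S) (hd : d ∈ G.bond S) : G.turn S d ∈ G.bond S := by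
  have hmem := iterate_run_add_one_mem (G := G) hd.1
  rw [Function.iterate_succ_apply', hS.next_mem_iff] at hmem
  refine ⟨hmem, ?_⟩
  rw [rev_turn]
  exact iterate_notMem_of_le_run (hS.run_pos hd) le_rfl

/-- The cyclic order on a bond given by the faces outside `S`. -/
noncomputable def Invariant.turnPerm (hS : G.Invariant S) : Perm (G.bond S) :=
  Equiv.ofBijective (fun d => ⟨G.turn S d, hS.turn_mem d.2⟩) (Finite.injective_iff_bijective.1
    fun a b hab => Subtype.ext (injOn_turn a.2 b.2 (congrArg Subtype.val hab)))

end Finite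

section Planar

variable [Fintype D]

/- On the two sides of the cut, a potential of the flow through `U` is constant, so the flow through
every edge of the bond is the same. -/
theorem IsCut.bond_subset_of_balanced (hG : G.IsPlanar) (hS : G.IsCut S) {U : Finset D}
    (hU : ↑U ⊆ G.bond S) (hne : U.Nonempty)
    (hbal : ∀ h ∈ invariantFunctions G.next, ∑ d ∈ U, h d = ∑ d ∈ U, h (G.rev d)) :
    G.bond S ⊆ U := by
  classical
  let flow (d : D) : ℝ := (if d ∈ U then 1 else 0) - if G.rev d ∈ U then 1 else 0
  have flow_orthogonal (h : D → ℝ) (hh : h ∈ invariantFunctions G.next) : h ⬝ᵥ flow = 0 := by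
    have inflow : ∑ d, (if G.rev d ∈ U then h d else 0) = ∑ d ∈ U, h (G.rev d) := by
      rw [← Equiv.sum_comp G.rev]
      simp [G.rev_rev]
    simp [flow, dotProduct, mul_sub, inflow, hbal h hh]
  obtain ⟨g, hg, hgrad⟩ := hG ⟨fun d => by simp [flow, G.rev_rev], flow_orthogonal⟩
  have flow_eq (d : D) : g (G.rev d) - g d = flow d := congrFun hgrad d
  have rev_notMem {d : D} (hd : d ∈ G.bond S) : G.rev d ∉ U := fun h => hd.2 (hU h).1
  have const_of_same_side (d : D) (hd : d ∈ S ↔ G.rev d ∈ S) : g (G.rev d) = g d := by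
    have h1 : d ∉ U := fun h => (hU h).2 (hd.1 (hU h).1)
    have h2 : G.rev d ∉ U := fun h => (hU h).2 (by rw [G.rev_rev]; exact hd.2 (hU h).1)
    simpa [flow, h1, h2, sub_eq_zero] using flow_eq d
  intro b hb
  obtain ⟨a, ha⟩ := hne
  have inside : g a = g b := hS.conn.eq_of_invariant hg
    (fun d h1 h2 => const_of_same_side d (iff_of_true h1 h2)) (hU ha).1 hb.1
  have outside : g (G.rev a) = g (G.rev b) := hS.conn_compl.eq_of_invariant hg
    (fun d h1 h2 => const_of_same_side d (iff_of_false h1 h2)) (hU ha).2 hb.2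
  by_contra hbU
  rw [Finset.mem_coe] at hbU
  have flow_a := flow_eq a
  have flow_b := flow_eq b
  simp only [flow, ha, rev_notMem (hU ha), rev_notMem hb, if_true, if_false] at flow_a flow_b
  rw [inside, outside, flow_b, if_neg hbU] at flow_a
  norm_num at flow_a

theorem IsCut.sameCycle_of_follows_faces (hG : G.IsPlanar) (hS : G.IsCut S) {σ : Perm (G.bond S)}
    (hσ : ∀ d : G.bond S, G.next.SameCycle d.1 (G.rev (σ d))) (a b : G.bond S) :
    σ.SameCycle a b := by
  classical
  let orbit : Finset (G.bond S) := {x | σ.SameCycle a x}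
  have bond_subset := hS.bond_subset_of_balanced hG
    (U := orbit.map (Function.Embedding.subtype _))
    (by
      intro d hd
      obtain ⟨x, -, rfl⟩ := Finset.mem_map.1 (Finset.mem_coe.1 hd)
      exact x.2)
    (Finset.map_nonempty.2 ⟨a, by simp [orbit, SameCycle.refl]⟩)
    (fun h hh => by
      simp only [Finset.sum_map, Function.Embedding.subtype_apply]
      exact Finset.sum_equiv σ (fun x => by simp [orbit]) fun x _ => eq_of_sameCycle hh (hσ x))
  obtain ⟨x, hx, hxb⟩ := Finset.mem_map.1 (Finset.mem_coe.1 (bond_subset b.2))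
  rw [← show x = b from Subtype.ext hxb]
  simpa [orbit] using hx

theorem IsCut.turnPerm_sameCycle (hG : G.IsPlanar) (hS : G.IsCut S) (a b : G.bond S) :
    hS.invariant.turnPerm.SameCycle a b :=
  hS.sameCycle_of_follows_faces hG (fun d => sameCycle_rev_turn S d.1) a b

/- If the face of `a` also contained `b ≠ a`, then composing `turnPerm` with the transposition of
the two would still follow the faces; but this changes the sign, while the two permutations are
full cycles. -/
theorem IsCut.eq_of_mem_bond_of_sameCycle (hG : G.IsPlanar) (hS : G.IsCut S) (ha : a ∈ G.bond S)
    (hb : b ∈ G.bond S) (hab : G.next.SameCycle a b) : a = b := by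
  classical
  refine congrArg Subtype.val (eq_of_forall_sameCycle_mul_swap (a := ⟨a, ha⟩) (b := ⟨b, hb⟩)
    (hS.turnPerm_sameCycle hG) (hS.sameCycle_of_follows_faces hG fun d => ?_))
  refine SameCycle.trans ?_ (sameCycle_rev_turn S _)
  rw [swap_apply_def]
  split_ifs with hda hdb
  · rwa [hda]
  · rw [hdb]
    exact hab.symm
  · exact SameCycle.refl _ _

theorem IsCut.iterate_mem_of_run_lt (hG : G.IsPlanar) (hS : G.IsCut S) (hd : d ∈ G.bond S) {s : ℕ}
    (hs : G.run S d < s) (hsp : s ≤ Function.minimalPeriod G.next d) : G.next^[s] d ∈ S := by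
  induction s, hs using Nat.le_induction with
  | base => exact iterate_run_add_one_mem hd.1
  | succ s hs ih =>
    by_contra hnotMem
    rw [Function.iterate_succ_apply', hS.invariant.next_mem_iff] at hnotMem
    have periodic := hS.eq_of_mem_bond_of_sameCycle hG hd ⟨ih (by omega), hnotMem⟩
      (sameCycle_iterate _ _ _)
    have := Function.IsPeriodicPt.minimalPeriod_le (n := s) (by omega) periodic.symm
    omega

end Planar

variable (G S) in
/-- The restriction of a function on darts to the edges of the subgraph spanned by the vertices in
`S`, extended by zero. -/
noncomputable def restrict : (D → ℝ) →ₗ[ℝ] D → ℝ where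
  toFun := Set.indicator {d | d ∈ S ∧ G.rev d ∈ S}
  map_add' := Set.indicator_add _
  map_smul' c f := Set.indicator_const_smul _ c f

theorem restrict_of_mem {f : D → ℝ} {d : D} (hd : d ∈ S) (hd' : G.rev d ∈ S) :
    G.restrict S f d = f d :=
  Set.indicator_of_mem (s := {d | d ∈ S ∧ G.rev d ∈ S}) ⟨hd, hd'⟩ f

theorem restrict_of_notMem {f : D → ℝ} {d : D} (hd : ¬(d ∈ S ∧ G.rev d ∈ S)) :
    G.restrict S f d = 0 :=
  Set.indicator_of_notMem (s := {d | d ∈ S ∧ G.rev d ∈ S}) hd f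

theorem restrict_grad (f : D → ℝ) : G.restrict S (G.grad f) = G.grad (G.restrict S f) := by
  ext d
  by_cases hd : d ∈ S ∧ G.rev d ∈ S
  · have hd' : G.rev (G.rev d) ∈ S := (G.rev_rev d).symm ▸ hd.1
    simp [restrict_of_mem hd.1 hd.2, restrict_of_mem hd.2 hd']
  · have hd' : ¬(G.rev d ∈ S ∧ G.rev (G.rev d) ∈ S) := by rwa [G.rev_rev, and_comm]
    simp [restrict_of_notMem hd, restrict_of_notMem hd']

theorem restrict_dotProduct [Fintype D] (f h : D → ℝ) :
    G.restrict S f ⬝ᵥ h = f ⬝ᵥ G.restrict S h := by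
  refine Finset.sum_congr rfl fun d _ => ?_
  by_cases hd : d ∈ S ∧ G.rev d ∈ S
  · rw [restrict_of_mem hd.1 hd.2, restrict_of_mem hd.1 hd.2]
  · rw [restrict_of_notMem hd, restrict_of_notMem hd, zero_mul, mul_zero]

variable [Fintype D]

theorem IsPlanar.exists_face_potential (hG : G.IsPlanar) (hS : G.Invariant S) (hS' : G.Conn Sᶜ)
    {z : D → ℝ} (hz : z ∈ G.antisymmetric) (hdiv : z ∈ dotOrthogonal (invariantFunctions G.rot))
    (hsupp : ∀ d, ¬(d ∈ S ∧ G.rev d ∈ S) → z d = 0) :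
    ∃ k ∈ invariantFunctions G.next, (∀ d ∉ S, k d = 0) ∧ G.grad k = z := by
  obtain ⟨k, hk, hkz⟩ := hG.dual ⟨hz, hdiv⟩
  have rev_eq (d : D) (hd : ¬(d ∈ S ∧ G.rev d ∈ S)) : k (G.rev d) = k d :=
    sub_eq_zero.1 ((congrFun hkz d).trans (hsupp d hd))
  have rot_eq (d : D) (hd : d ∉ S) : k (G.rot d) = k d := by
    rw [← rev_eq (G.rot d) fun h => hd ((hS d).1 h.1), ← hk, next_rev_rot]
  obtain ⟨c, hc⟩ : ∃ c, ∀ d ∉ S, k d = c := by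
    by_cases hne : ∃ o, o ∉ S
    · obtain ⟨o, ho⟩ := hne
      refine ⟨k o, fun d hd => ?_⟩
      have component : G.Saturated Sᶜ (Sᶜ ∩ {d | k d = k o}) :=
        ⟨fun d => by
          by_cases hd : d ∈ S
          · simp [hd, (hS d).2 hd]
          · simp [hd, hS d, rot_eq d hd],
        fun d h1 h2 => by
          simp only [Set.mem_inter_iff, h1, h2, true_and, Set.mem_ofPred_eq,
            rev_eq d fun h => h1 h.1]⟩
      exact (hS'.subset component ho ⟨ho, rfl⟩ hd).2
    · exact ⟨0, fun d hd => absurd ⟨d, hd⟩ hne⟩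
  refine ⟨fun d => k d - c, fun d => by simp only [hk d], fun d hd => by simp [hc d hd], ?_⟩
  rw [← hkz]
  ext d
  simp

theorem IsPlanar.exists_potential_on (hG : G.IsPlanar) (hS : G.Invariant S) (hS' : G.Conn Sᶜ)
    {f : D → ℝ} (hf : f ∈ G.antisymmetric) (hsupp : ∀ d, ¬(d ∈ S ∧ G.rev d ∈ S) → f d = 0)
    (hcurl : ∀ h ∈ invariantFunctions G.next, (∀ d ∉ S, h d = 0) → f ⬝ᵥ h = 0) :
    ∃ g ∈ invariantFunctions G.rot, ∀ d ∈ S, G.rev d ∈ S → f d = g (G.rev d) - g d := by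
  suffices f ∈ (invariantFunctions G.rot).map (G.restrict S ∘ₗ G.grad) by
    obtain ⟨g, hg, rfl⟩ := this
    exact ⟨g, hg, fun d hd hd' => restrict_of_mem hd hd'⟩
  refine mem_of_forall_dotProduct_eq_zero fun y hy => ?_
  obtain ⟨k, hk, hkS, hkz⟩ := hG.exists_face_potential hS hS' (z := G.restrict S (G.grad y))
    (by rw [restrict_grad]; exact G.grad_mem_antisymmetric _)
    (fun h hh => by
      refine Eq.trans ?_ (hy _ ⟨h, hh, rfl⟩)
      change h ⬝ᵥ G.restrict S (G.grad y) = G.restrict S (G.grad h) ⬝ᵥ y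
      rw [restrict_grad, restrict_grad, grad_dotProduct, restrict_dotProduct, restrict_grad])
    (fun d hd => restrict_of_notMem hd)
  have restrict_f : G.restrict S f = f := by
    ext d
    by_cases hd : d ∈ S ∧ G.rev d ∈ S
    · exact restrict_of_mem hd.1 hd.2
    · rw [restrict_of_notMem hd, hsupp d hd]
  have pairing : (-2 : ℝ) • (f ⬝ᵥ y) = (-2 : ℝ) • (f ⬝ᵥ k) := by
    rw [← smul_dotProduct, ← smul_dotProduct, ← grad_of_antisymmetric hf, grad_dotProduct,
      grad_dotProduct, hkz, ← restrict_dotProduct, restrict_f]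
  rw [hcurl k hk hkS, smul_zero, smul_eq_zero_iff_right (by norm_num)] at pairing
  rw [dotProduct_comm, pairing]

end RotationSystem

/-! ### Splicing -/

theorem sum_subtype_of_forall_eq_zero {α : Type*} [Fintype α] {p : α → Prop}
    [Fintype (Subtype p)] {F : α → ℝ} (hF : ∀ a, ¬p a → F a = 0) :
    ∑ x : Subtype p, F x = ∑ a, F a := by
  classical
  rw [← Finset.sum_subtype ({a | p a} : Finset α) (fun x => by simp) F, Finset.sum_filter]
  refine Finset.sum_congr rfl fun a _ => ?_
  split_ifs with ha
  · rfl
  · exact (hF a ha).symm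

namespace RotationSystem

variable {D : Type*} {G : RotationSystem D}

variable (G) in
/-- Two nested cuts of a plane graph whose bonds are crossed by the faces in the same pattern, so
that the part of the graph between them can be cut out. -/
structure Splice [Fintype D] (S₁ S₂ : Set D) where
  planar : G.IsPlanar
  cut₁ : G.IsCut S₁
  cut₂ : G.IsCut S₂
  subset : S₁ ⊆ S₂
  nonempty : (G.bond S₁).Nonempty
  /-- The correspondence between the two bonds. -/
  e : G.bond S₁ ≃ G.bond S₂
  turn_e : ∀ b, e (cut₁.invariant.turnPerm b) = cut₂.invariant.turnPerm (e b)
  run_e : ∀ b, G.run S₂ (e b) = G.run S₁ b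
  period_e : ∀ b, Function.minimalPeriod G.next (e b).1 = Function.minimalPeriod G.next b.1

namespace Splice

variable [Fintype D] {S₁ S₂ : Set D}

/-- The darts that remain when the part between the two bonds is cut out. -/
abbrev Dart (_ : G.Splice S₁ S₂) : Type _ := {d : D // d ∈ S₁ ∨ d ∉ S₂}

variable (s : G.Splice S₁ S₂) {b b' : G.bond S₁} {x y : s.Dart}

/-- A dart of the inner bond, as a dart of the spliced graph. -/
def ofBond (b : G.bond S₁) : s.Dart := ⟨b.1, Or.inl b.2.1⟩

/-- The reverse of the dart of the outer bond that corresponds to `b`, as a dart of the spliced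
graph. -/
def ofRevBond (b : G.bond S₁) : s.Dart := ⟨G.rev (s.e b).1, Or.inr (s.e b).2.2⟩

variable {s} in
/-- The edge of `x` lies on one side of the seam along which the two bonds are glued. -/
def OffSeam (x : s.Dart) : Prop :=
  (x.1 ∈ S₁ ∧ G.rev x.1 ∈ S₁) ∨ (x.1 ∉ S₂ ∧ G.rev x.1 ∉ S₂)

theorem seam_cases (x : s.Dart) :
    (∃ b, x = s.ofBond b) ∨ (∃ b, x = s.ofRevBond b) ∨ OffSeam x := by
  by_cases hx₁ : x.1 ∈ S₁
  · by_cases hx : G.rev x.1 ∈ S₁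
    · exact Or.inr (Or.inr (Or.inl ⟨hx₁, hx⟩))
    · exact Or.inl ⟨⟨x.1, hx₁, hx⟩, rfl⟩
  · have hx₂ := x.2.resolve_left hx₁
    by_cases hx : G.rev x.1 ∈ S₂
    · have mem_bond : G.rev x.1 ∈ G.bond S₂ := ⟨hx, by rwa [G.rev_rev]⟩
      refine Or.inr (Or.inl ⟨s.e.symm ⟨_, mem_bond⟩, Subtype.ext ?_⟩)
      simp [ofRevBond, G.rev_rev]
    · exact Or.inr (Or.inr (Or.inr ⟨hx₂, hx⟩))

theorem ofBond_mem (b : G.bond S₁) : (s.ofBond b).1 ∈ S₁ := b.2.1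

theorem ofRevBond_notMem (b : G.bond S₁) : (s.ofRevBond b).1 ∉ S₁ := fun h =>
  (s.e b).2.2 (s.subset h)

theorem ofBond_ne_ofRevBond (b b' : G.bond S₁) : s.ofBond b ≠ s.ofRevBond b' := fun h =>
  s.ofRevBond_notMem b' (h ▸ b.2.1)

open Classical in
/-- The edges of the inner bond are glued to the corresponding edges of the outer bond. -/
noncomputable def glueRev (x : s.Dart) : s.Dart :=
  if h₁ : x.1 ∈ G.bond S₁ then s.ofRevBond ⟨x.1, h₁⟩
  else if h₂ : G.rev x.1 ∈ G.bond S₂ then s.ofBond (s.e.symm ⟨G.rev x.1, h₂⟩)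
  else ⟨G.rev x.1, by
    by_cases hx : x.1 ∈ S₁
    · exact Or.inl (not_not.1 fun h => h₁ ⟨hx, h⟩)
    · exact Or.inr fun h => h₂ ⟨h, by rw [G.rev_rev]; exact x.2.resolve_left hx⟩⟩

theorem glueRev_ofBond (b : G.bond S₁) : s.glueRev (s.ofBond b) = s.ofRevBond b := dif_pos b.2

theorem glueRev_ofRevBond (b : G.bond S₁) : s.glueRev (s.ofRevBond b) = s.ofBond b := by
  have rev_eq : G.rev (s.ofRevBond b).1 = (s.e b).1 := G.rev_rev _
  rw [glueRev, dif_neg fun h => s.ofRevBond_notMem b h.1, dif_pos (rev_eq ▸ (s.e b).2)]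
  exact congrArg s.ofBond (s.e.symm_apply_eq.2 (Subtype.ext rev_eq))

variable {s}

theorem OffSeam.glueRev_val (hx : OffSeam x) : (s.glueRev x).1 = G.rev x.1 := by
  have h₁ : x.1 ∉ G.bond S₁ := fun h =>
    hx.elim (fun hx => h.2 hx.2) fun hx => hx.1 (s.subset h.1)
  have h₂ : G.rev x.1 ∉ G.bond S₂ := fun h =>
    hx.elim (fun hx => h.2 (by rw [G.rev_rev]; exact s.subset hx.1)) fun hx => hx.2 h.1
  rw [glueRev, dif_neg h₁, dif_neg h₂]

theorem OffSeam.mem_iff (hx : OffSeam x) : G.rev x.1 ∈ S₁ ↔ x.1 ∈ S₁ :=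
  hx.elim (fun h => iff_of_true h.2 h.1) fun h =>
    iff_of_false (fun h' => h.2 (s.subset h')) fun h' => h.1 (s.subset h')

theorem OffSeam.glueRev (hx : OffSeam x) : OffSeam (s.glueRev x) := by
  rw [OffSeam, hx.glueRev_val, G.rev_rev]
  exact hx.imp And.symm And.symm

variable (s)

theorem glueRev_glueRev (x : s.Dart) : s.glueRev (s.glueRev x) = x := by
  rcases s.seam_cases x with ⟨b, rfl⟩ | ⟨b, rfl⟩ | hx
  · rw [glueRev_ofBond, glueRev_ofRevBond]
  · rw [glueRev_ofRevBond, glueRev_ofBond]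
  · exact Subtype.ext (by rw [hx.glueRev.glueRev_val, hx.glueRev_val, G.rev_rev])

/-- The spliced graph. -/
noncomputable def glue : RotationSystem s.Dart where
  rev := ⟨s.glueRev, s.glueRev, s.glueRev_glueRev, s.glueRev_glueRev⟩
  rot := G.rot.subtypePerm fun d => by rw [s.cut₁.invariant d, s.cut₂.invariant d]
  rev_rev := s.glueRev_glueRev
  rev_ne x := by
    change s.glueRev x ≠ x
    rcases s.seam_cases x with ⟨b, rfl⟩ | ⟨b, rfl⟩ | hx
    · rw [glueRev_ofBond]
      exact (s.ofBond_ne_ofRevBond b b).symm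
    · rw [glueRev_ofRevBond]
      exact s.ofBond_ne_ofRevBond b b
    · exact fun h => G.rev_ne x.1 (hx.glueRev_val.symm.trans (congrArg Subtype.val h))

theorem rot_val (x : s.Dart) : (s.glue.rot x).1 = G.rot x.1 := rfl

theorem rev_ofBond (b : G.bond S₁) : s.glue.rev (s.ofBond b) = s.ofRevBond b :=
  s.glueRev_ofBond b

theorem rev_ofRevBond (b : G.bond S₁) : s.glue.rev (s.ofRevBond b) = s.ofBond b :=
  s.glueRev_ofRevBond b

variable {s}

theorem OffSeam.rev_val (hx : OffSeam x) : (s.glue.rev x).1 = G.rev x.1 := hx.glueRev_val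

theorem next_val_of_rev_val {d : D} (h : (s.glue.rev x).1 = G.rev d) :
    (s.glue.next x).1 = G.next d := by
  apply G.rot.injective
  rw [← rot_val, rot_next, rot_next, h]

theorem OffSeam.next_val (hx : OffSeam x) : (s.glue.next x).1 = G.next x.1 :=
  next_val_of_rev_val hx.rev_val

variable (s)

theorem next_ofBond (b : G.bond S₁) : (s.glue.next (s.ofBond b)).1 = G.next (s.e b).1 :=
  next_val_of_rev_val (by rw [rev_ofBond]; rfl)

theorem next_ofRevBond (b : G.bond S₁) :
    (s.glue.next (s.ofRevBond b)).1 = G.next (G.rev b.1) :=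
  next_val_of_rev_val (by rw [rev_ofRevBond, G.rev_rev]; rfl)

theorem iterate_next_of_le_run {k : ℕ} (hk : 1 ≤ k) (hkr : k ≤ G.run S₁ b) :
    (s.glue.next^[k] (s.ofBond b)).1 = G.next^[k] (s.e b).1 := by
  induction k, hk using Nat.le_induction with
  | base => exact s.next_ofBond b
  | succ k hk ih =>
    have ih := ih (by omega)
    have notMem : G.next^[k] (s.e b).1 ∉ S₂ :=
      iterate_notMem_of_le_run hk (by rw [s.run_e]; omega)
    have next_notMem : G.next^[k + 1] (s.e b).1 ∉ S₂ :=
      iterate_notMem_of_le_run (by omega) (by rw [s.run_e]; omega)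
    rw [Function.iterate_succ_apply', s.cut₂.invariant.next_mem_iff] at next_notMem
    rw [Function.iterate_succ_apply', OffSeam.next_val, ih, Function.iterate_succ_apply']
    rw [OffSeam, ih]
    exact Or.inr ⟨notMem, next_notMem⟩

theorem iterate_run_ofBond (b : G.bond S₁) :
    s.glue.next^[G.run S₁ b] (s.ofBond b) = s.ofRevBond (s.cut₁.invariant.turnPerm b) := by
  refine Subtype.ext ((s.iterate_next_of_le_run (s.cut₁.invariant.run_pos b.2) le_rfl).trans ?_)
  change _ = G.rev (s.e _).1
  rw [s.turn_e, ← s.run_e]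
  exact (rev_turn _).symm

theorem iterate_next_of_run_lt {k : ℕ} (hk : G.run S₁ b < k)
    (hkp : k ≤ Function.minimalPeriod G.next b.1) :
    (s.glue.next^[k] (s.ofBond b)).1 = G.next^[k] b.1 := by
  induction k, hk using Nat.le_induction with
  | base =>
    rw [Function.iterate_succ_apply', iterate_run_ofBond, next_ofRevBond,
      Function.iterate_succ_apply']
    exact congrArg G.next (rev_turn _)
  | succ k hk ih =>
    have ih := ih (by omega)
    have mem := s.cut₁.iterate_mem_of_run_lt s.planar b.2 hk (by omega)
    have next_mem := s.cut₁.iterate_mem_of_run_lt s.planar b.2 (s := k + 1) (by omega) hkp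
    rw [Function.iterate_succ_apply', s.cut₁.invariant.next_mem_iff] at next_mem
    rw [Function.iterate_succ_apply', OffSeam.next_val, ih, Function.iterate_succ_apply']
    rw [OffSeam, ih]
    exact Or.inl ⟨mem, next_mem⟩

theorem minimalPeriod_ofBond (b : G.bond S₁) :
    Function.minimalPeriod s.glue.next (s.ofBond b) = Function.minimalPeriod G.next b.1 := by
  have periodic :
      Function.IsPeriodicPt s.glue.next (Function.minimalPeriod G.next b.1) (s.ofBond b) :=
    Subtype.ext ((s.iterate_next_of_run_lt (run_lt b.2.1) le_rfl).trans
      Function.iterate_minimalPeriod)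
  refine le_antisymm (periodic.minimalPeriod_le (minimalPeriod_next_pos _)) ?_
  by_contra! hlt
  set m := Function.minimalPeriod s.glue.next (s.ofBond b)
  have hpos : 1 ≤ m := minimalPeriod_next_pos _
  have iterate_eq : (s.glue.next^[m] (s.ofBond b)).1 = b.1 :=
    congrArg Subtype.val (Function.iterate_minimalPeriod (f := s.glue.next))
  rcases le_or_gt m (G.run S₁ b) with hle | hgt
  · rw [s.iterate_next_of_le_run hpos hle] at iterate_eq
    exact iterate_notMem_of_le_run (S := S₂) hpos (by rwa [s.run_e])
      (iterate_eq ▸ s.subset b.2.1)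
  · rw [s.iterate_next_of_run_lt hgt hlt.le] at iterate_eq
    exact hlt.not_ge (Function.IsPeriodicPt.minimalPeriod_le (f := G.next) hpos iterate_eq)

variable {s}

/- The face contour of the spliced graph through a seam edge `b` follows the face of `s.e b` on the
outer part, then that of `b` on the inner part. -/
theorem exists_iterate_of_sameCycle_ofBond (h : s.glue.next.SameCycle (s.ofBond b) x) :
    x = s.ofBond b ∨
    (∃ k, 1 ≤ k ∧ k ≤ G.run S₁ b ∧ G.next^[k] (s.e b).1 = x.1 ∧ x.1 ∉ S₂) ∨
    ∃ k, G.run S₁ b < k ∧ k < Function.minimalPeriod G.next b.1 ∧ G.next^[k] b.1 = x.1 ∧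
      x.1 ∈ S₁ := by
  obtain ⟨k, hk, rfl⟩ := exists_iterate_eq_of_sameCycle h
  rw [minimalPeriod_ofBond] at hk
  rcases Nat.eq_zero_or_pos k with rfl | hpos
  · exact Or.inl rfl
  refine Or.inr ((le_or_gt k (G.run S₁ b)).imp (fun hle => ?_) fun hgt => ?_)
  · refine ⟨k, hpos, hle, (s.iterate_next_of_le_run hpos hle).symm, ?_⟩
    rw [s.iterate_next_of_le_run hpos hle]
    exact iterate_notMem_of_le_run hpos (by rwa [s.run_e])
  · refine ⟨k, hgt, hk, (s.iterate_next_of_run_lt hgt hk.le).symm, ?_⟩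
    rw [s.iterate_next_of_run_lt hgt hk.le]
    exact s.cut₁.iterate_mem_of_run_lt s.planar b.2 hgt hk.le

theorem sameCycle_of_mem (h : s.glue.next.SameCycle (s.ofBond b) x) (hx : x.1 ∈ S₁) :
    G.next.SameCycle b.1 x.1 := by
  rcases exists_iterate_of_sameCycle_ofBond h with rfl | ⟨k, -, -, -, hx₂⟩ | ⟨k, -, -, hk, -⟩
  · exact SameCycle.refl _ _
  · exact absurd (s.subset hx) hx₂
  · exact hk ▸ sameCycle_iterate _ _ _

theorem sameCycle_of_notMem (h : s.glue.next.SameCycle (s.ofBond b) x) (hx : x.1 ∉ S₂) :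
    G.next.SameCycle (s.e b).1 x.1 := by
  rcases exists_iterate_of_sameCycle_ofBond h with rfl | ⟨k, -, -, hk, -⟩ | ⟨k, -, -, -, hx₁⟩
  · exact absurd (s.subset b.2.1) hx
  · exact hk ▸ sameCycle_iterate _ _ _
  · exact absurd (s.subset hx₁) hx

theorem eq_of_sameCycle_ofBond (h : s.glue.next.SameCycle (s.ofBond b) (s.ofBond b')) : b = b' :=
  Subtype.ext (s.cut₁.eq_of_mem_bond_of_sameCycle s.planar b.2 b'.2 (sameCycle_of_mem h b'.2.1))

variable (s) in
theorem sameCycle_ofRevBond_turnPerm (b : G.bond S₁) :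
    s.glue.next.SameCycle (s.ofBond b) (s.ofRevBond (s.cut₁.invariant.turnPerm b)) := by
  rw [← iterate_run_ofBond]
  exact sameCycle_iterate _ _ _

theorem eq_turnPerm_of_sameCycle (h : s.glue.next.SameCycle (s.ofBond b) (s.ofRevBond b')) :
    b' = s.cut₁.invariant.turnPerm b := by
  have h' := s.sameCycle_ofRevBond_turnPerm (s.cut₁.invariant.turnPerm.symm b')
  rw [Equiv.apply_symm_apply] at h'
  rw [eq_of_sameCycle_ofBond (h.trans h'.symm), Equiv.apply_symm_apply]

theorem sameCycle_ofBond_of_mem (hx : x.1 ∈ S₁) (h : G.next.SameCycle b.1 x.1) :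
    s.glue.next.SameCycle (s.ofBond b) x := by
  obtain ⟨k, hk, hkx⟩ := exists_iterate_eq_of_sameCycle h
  rcases Nat.eq_zero_or_pos k with rfl | hpos
  · rw [show x = s.ofBond b from Subtype.ext hkx.symm]
  rcases le_or_gt k (G.run S₁ b) with hle | hgt
  · exact absurd (hkx ▸ hx) (iterate_notMem_of_le_run hpos hle)
  · rw [← s.iterate_next_of_run_lt hgt hk.le] at hkx
    exact Subtype.ext hkx ▸ sameCycle_iterate _ _ _

theorem sameCycle_ofBond_of_notMem (hx : x.1 ∉ S₂) (h : G.next.SameCycle (s.e b).1 x.1) :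
    s.glue.next.SameCycle (s.ofBond b) x := by
  obtain ⟨k, hk, hkx⟩ := exists_iterate_eq_of_sameCycle h
  rcases Nat.eq_zero_or_pos k with rfl | hpos
  · exact absurd (hkx ▸ (s.e b).2.1) hx
  rcases le_or_gt k (G.run S₁ b) with hle | hgt
  · rw [← s.iterate_next_of_le_run hpos hle] at hkx
    exact Subtype.ext hkx ▸ sameCycle_iterate _ _ _
  · refine absurd ?_ hx
    rw [← hkx]
    exact s.cut₂.iterate_mem_of_run_lt s.planar (s.e b).2 (by rwa [s.run_e]) hk.le

theorem iterate_next_val (hx : ∀ b, ¬s.glue.next.SameCycle (s.ofBond b) x) (n : ℕ) :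
    (s.glue.next^[n] x).1 = G.next^[n] x.1 := by
  induction n with
  | zero => rfl
  | succ n ih =>
    rw [Function.iterate_succ_apply', Function.iterate_succ_apply', ← ih]
    have hy (b) : ¬s.glue.next.SameCycle (s.ofBond b) (s.glue.next^[n] x) := fun h =>
      hx b (h.trans (sameCycle_iterate _ _ _).symm)
    rcases s.seam_cases (s.glue.next^[n] x) with ⟨b, hb⟩ | ⟨b, hb⟩ | hoff
    · exact absurd (hb ▸ SameCycle.refl _ _) (hy b)
    · obtain ⟨a, rfl⟩ := s.cut₁.invariant.turnPerm.surjective b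
      exact absurd (hb ▸ s.sameCycle_ofRevBond_turnPerm a) (hy a)
    · exact hoff.next_val

theorem sameCycle_iff_of_forall (hx : ∀ b, ¬s.glue.next.SameCycle (s.ofBond b) x) :
    s.glue.next.SameCycle x y ↔ G.next.SameCycle x.1 y.1 := by
  constructor <;> intro h <;> obtain ⟨n, -, hn⟩ := exists_iterate_eq_of_sameCycle h
  · rw [← hn, iterate_next_val hx]
    exact sameCycle_iterate _ _ _
  · rw [← iterate_next_val hx] at hn
    exact Subtype.ext hn ▸ sameCycle_iterate _ _ _

theorem sameCycle_of_mem_mem (hx : x.1 ∈ S₁) (hy : y.1 ∈ S₁) (h : G.next.SameCycle x.1 y.1) :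
    s.glue.next.SameCycle x y := by
  by_cases hb : ∃ b, s.glue.next.SameCycle (s.ofBond b) x
  · obtain ⟨b, hb⟩ := hb
    exact hb.symm.trans (sameCycle_ofBond_of_mem hy ((sameCycle_of_mem hb hx).trans h))
  · exact (sameCycle_iff_of_forall (not_exists.1 hb)).2 h

end Splice

theorem Invariant.eq_zero_of_supported {S : Set D} (hS : G.Invariant S) {h : D → ℝ}
    (hh : h ∈ invariantFunctions G.next) (hsupp : ∀ d ∉ S, h d = 0) {d : D}
    (hd : ¬(d ∈ S ∧ G.rev d ∈ S)) : h d = 0 := by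
  by_cases hdS : d ∈ S
  · rw [← hh]
    exact hsupp _ fun h => hd ⟨hdS, (hS.next_mem_iff d).1 h⟩
  · exact hsupp d hdS

namespace Splice

variable [Fintype D] {S₁ S₂ S : Set D} {s : G.Splice S₁ S₂}

variable (s) in
theorem exists_offSeam (hS : S = S₁ ∨ S = S₂ᶜ) {d : D} (hd : d ∈ S) (hd' : G.rev d ∈ S) :
    ∃ x : s.Dart, OffSeam x ∧ x.1 = d := by
  rcases hS with rfl | rfl
  · exact ⟨⟨d, Or.inl hd⟩, Or.inl ⟨hd, hd'⟩, rfl⟩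
  · exact ⟨⟨d, Or.inr hd⟩, Or.inr ⟨hd, hd'⟩, rfl⟩

theorem saturated_image (hS : S = S₁ ∨ S = S₂ᶜ) {T : Set s.Dart}
    (hT : s.glue.Saturated Set.univ T) : G.Saturated S (Subtype.val '' T) := by
  have mem_image (x : s.Dart) : x.1 ∈ Subtype.val '' T ↔ x ∈ T :=
    Subtype.val_injective.mem_set_image
  refine ⟨fun d => ⟨?_, ?_⟩, fun d hd hd' => ?_⟩
  · rintro ⟨x, hx, hxd⟩
    refine ⟨s.glue.rot.symm x, (hT.1 _).1 (by rwa [apply_symm_apply]), G.rot.injective ?_⟩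
    rw [← hxd, ← rot_val, apply_symm_apply]
  · rintro ⟨x, hx, rfl⟩
    exact ⟨s.glue.rot x, (hT.1 x).2 hx, rfl⟩
  · obtain ⟨x, hoff, rfl⟩ := s.exists_offSeam hS hd hd'
    rw [← hoff.rev_val, mem_image, mem_image]
    exact hT.2 x trivial trivial

variable (s) in
theorem glue_conn : s.glue.Conn Set.univ := by
  obtain ⟨b, hb⟩ := s.nonempty
  refine conn_of_forall_saturated (s.ofBond ⟨b, hb⟩) fun T hT hbT x _ => ?_
  have rev_mem : s.ofRevBond ⟨b, hb⟩ ∈ T :=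
    s.rev_ofBond _ ▸ (hT.2 _ trivial trivial).2 hbT
  rw [← Subtype.val_injective.mem_set_image]
  exact x.2.elim
    (fun hx => s.cut₁.conn.subset (saturated_image (Or.inl rfl) hT) hb.1 ⟨_, hbT, rfl⟩ hx)
    fun hx => s.cut₂.conn_compl.subset (saturated_image (Or.inr rfl) hT) (s.e _).2.2
      ⟨_, rev_mem, rfl⟩ hx

theorem invariant_of_eq (s : G.Splice S₁ S₂) (hS : S = S₁ ∨ S = S₂ᶜ) : G.Invariant S := by
  rcases hS with rfl | rfl
  exacts [s.cut₁.invariant, s.cut₂.invariant.compl]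

variable (s) in
theorem comp_val_mem_invariantFunctions (hS : S = S₁ ∨ S = S₂ᶜ) {h : D → ℝ}
    (hh : h ∈ invariantFunctions G.next) (hsupp : ∀ d ∉ S, h d = 0) :
    (fun x : s.Dart => h x.1) ∈ invariantFunctions s.glue.next := by
  have inner (b : G.bond S₁) : ¬(b.1 ∈ S ∧ G.rev b.1 ∈ S) := by
    rcases hS with rfl | rfl
    exacts [fun h => b.2.2 h.2, fun h => h.1 (s.subset b.2.1)]
  have outer (b : G.bond S₁) : ¬((s.e b).1 ∈ S ∧ G.rev (s.e b).1 ∈ S) := by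
    rcases hS with rfl | rfl
    exacts [fun h => (s.e b).2.2 (s.subset h.2), fun h => h.1 (s.e b).2.1]
  have eq_zero {d : D} := (s.invariant_of_eq hS).eq_zero_of_supported hh hsupp (d := d)
  have rev_eq_zero {d : D} (hd : ¬(d ∈ S ∧ G.rev d ∈ S)) : h (G.rev d) = 0 :=
    eq_zero (by rwa [G.rev_rev, and_comm])
  intro x
  change h (s.glue.next x).1 = h x.1
  rcases s.seam_cases x with ⟨b, rfl⟩ | ⟨b, rfl⟩ | hx
  · rw [next_ofBond, hh, eq_zero (outer b)]
    exact (eq_zero (inner b)).symm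
  · rw [next_ofRevBond, hh, rev_eq_zero (inner b)]
    exact (rev_eq_zero (outer b)).symm
  · rw [hx.next_val, hh]

theorem exists_extension (hS : S = S₁ ∨ S = S₂ᶜ) {f : s.Dart → ℝ}
    (hf : f ∈ s.glue.antisymmetric) :
    ∃ F ∈ G.antisymmetric, (∀ d, ¬(d ∈ S ∧ G.rev d ∈ S) → F d = 0) ∧
      ∀ x : s.Dart, x.1 ∈ S → G.rev x.1 ∈ S → F x.1 = f x := by
  let F : D → ℝ := G.restrict S (Function.extend Subtype.val f 0)
  have F_val (x : s.Dart) (hx : x.1 ∈ S) (hx' : G.rev x.1 ∈ S) : F x.1 = f x :=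
    (restrict_of_mem hx hx').trans (Subtype.val_injective.extend_apply _ _ _)
  have F_supp (d : D) (hd : ¬(d ∈ S ∧ G.rev d ∈ S)) : F d = 0 := restrict_of_notMem hd
  refine ⟨F, fun d => ?_, F_supp, F_val⟩
  by_cases hd : d ∈ S ∧ G.rev d ∈ S
  · obtain ⟨x, hoff, rfl⟩ := s.exists_offSeam hS hd.1 hd.2
    have F_rev := F_val (s.glue.rev x) (by rw [hoff.rev_val]; exact hd.2)
      (by rw [hoff.rev_val, G.rev_rev]; exact hd.1)
    rw [F_val x hd.1 hd.2, ← hf x, ← F_rev, hoff.rev_val]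
  · rw [F_supp d hd, F_supp _ (by rwa [G.rev_rev, and_comm]), neg_zero]

variable [Fintype s.Dart] {f u : s.Dart → ℝ}

theorem exists_potential_in (hS : S = S₁ ∨ S = S₂ᶜ) (hf : f ∈ s.glue.antisymmetric)
    (hcurl : f ∈ dotOrthogonal (invariantFunctions s.glue.next)) :
    ∃ g ∈ invariantFunctions G.rot, ∀ x : s.Dart, x.1 ∈ S → G.rev x.1 ∈ S →
      f x = g (G.rev x.1) - g x.1 := by
  obtain ⟨F, F_antisymmetric, F_supp, F_val⟩ := exists_extension hS hf
  have conn_compl : G.Conn Sᶜ := by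
    rcases hS with rfl | rfl
    exacts [s.cut₁.conn_compl, (compl_compl S₂).symm ▸ s.cut₂.conn]
  have F_curl (h : D → ℝ) (hh : h ∈ invariantFunctions G.next) (hsupp : ∀ d ∉ S, h d = 0) :
      F ⬝ᵥ h = 0 := by
    refine Eq.trans ?_ (mem_dotOrthogonal.1 hcurl _ (s.comp_val_mem_invariantFunctions hS hh hsupp))
    have F_eq_zero (d : D) (hd : ¬(d ∈ S₁ ∨ d ∉ S₂)) : F d * h d = 0 := by
      rw [F_supp d, zero_mul]
      rintro ⟨h1, h2⟩
      obtain ⟨x, -, rfl⟩ := s.exists_offSeam hS h1 h2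
      exact hd x.2
    rw [dotProduct, ← sum_subtype_of_forall_eq_zero F_eq_zero]
    refine Finset.sum_congr rfl fun x _ => ?_
    by_cases hx : x.1 ∈ S ∧ G.rev x.1 ∈ S
    · rw [F_val x hx.1 hx.2, mul_comm]
    · have h_eq_zero := (s.invariant_of_eq hS).eq_zero_of_supported hh hsupp hx
      simp only [h_eq_zero, mul_zero, zero_mul]
  obtain ⟨g, hg, hgF⟩ := s.planar.exists_potential_on (s.invariant_of_eq hS) conn_compl
    F_antisymmetric F_supp F_curl
  exact ⟨g, hg, fun x hx hx' => by rw [← F_val x hx hx', hgF x.1 hx hx']⟩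

theorem exists_potential_off_seam (hf : f ∈ s.glue.antisymmetric)
    (hcurl : f ∈ dotOrthogonal (invariantFunctions s.glue.next)) :
    ∃ g ∈ invariantFunctions s.glue.rot, ∀ x, OffSeam x → f x = s.glue.grad g x := by
  classical
  obtain ⟨g₁, hg₁, hfg₁⟩ := exists_potential_in (Or.inl rfl) hf hcurl
  obtain ⟨g₂, hg₂, hfg₂⟩ := exists_potential_in (Or.inr rfl) hf hcurl
  refine ⟨fun x => if x.1 ∈ S₁ then g₁ x.1 else g₂ x.1, fun x => ?_, fun x hx => ?_⟩
  · simp only [rot_val, s.cut₁.invariant x.1, hg₁ x.1, hg₂ x.1]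
  · simp only [grad_apply, hx.rev_val, hx.mem_iff]
    split_ifs with hx₁
    · exact hfg₁ x hx₁ (hx.mem_iff.2 hx₁)
    · have hx₂ := hx.resolve_left fun h => hx₁ h.1
      exact hfg₂ x hx₂.1 hx₂.2

/- A face that crosses the seam does so exactly once in each direction. -/
theorem eq_on_seam (hu : u ∈ s.glue.antisymmetric)
    (hcurl : u ∈ dotOrthogonal (invariantFunctions s.glue.next))
    (hsupp : ∀ x, OffSeam x → u x = 0) (b b' : G.bond S₁) :
    u (s.ofBond b) = u (s.ofBond b') := by
  classical
  refine eq_of_sameCycle (h := fun b => u (s.ofBond b)) (fun b => ?_)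
    (s.cut₁.turnPerm_sameCycle s.planar b b')
  have flux := mem_dotOrthogonal.1 hcurl
    (fun x => if s.glue.next.SameCycle (s.ofBond b) x then 1 else 0)
    fun x => by simp only [sameCycle_apply_right]
  set b₁ := s.cut₁.invariant.turnPerm b
  rw [dotProduct, Fintype.sum_eq_add _ _ (s.ofBond_ne_ofRevBond b b₁),
    if_pos (SameCycle.refl _ _), if_pos (s.sameCycle_ofRevBond_turnPerm b), ← s.rev_ofBond,
    hu] at flux
  · linarith
  · rintro x ⟨hxb, hxb'⟩
    rcases s.seam_cases x with ⟨a, rfl⟩ | ⟨a, rfl⟩ | hx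
    · rw [if_neg fun h => hxb (by rw [eq_of_sameCycle_ofBond h]), zero_mul]
    · rw [if_neg fun h => hxb' (by rw [eq_turnPerm_of_sameCycle h]), zero_mul]
    · rw [hsupp x hx, mul_zero]

theorem mem_map_grad_of_off_seam (hu : u ∈ s.glue.antisymmetric)
    (hcurl : u ∈ dotOrthogonal (invariantFunctions s.glue.next))
    (hsupp : ∀ x, OffSeam x → u x = 0) : u ∈ (invariantFunctions s.glue.rot).map s.glue.grad := by
  classical
  obtain ⟨b₀, hb₀⟩ := s.nonempty
  set c := u (s.ofBond ⟨b₀, hb₀⟩)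
  have seam_eq (b : G.bond S₁) : u (s.ofBond b) = c := eq_on_seam hu hcurl hsupp _ _
  refine ⟨fun x => if x.1 ∈ S₁ then 0 else c, fun x => ?_, funext fun x => ?_⟩
  · simp only [rot_val, s.cut₁.invariant x.1]
  · rw [grad_apply]
    rcases s.seam_cases x with ⟨b, rfl⟩ | ⟨b, rfl⟩ | hx
    · rw [rev_ofBond, if_neg (s.ofRevBond_notMem b), if_pos (s.ofBond_mem b), seam_eq, sub_zero]
    · rw [rev_ofRevBond, if_neg (s.ofRevBond_notMem b), if_pos (s.ofBond_mem b), ← rev_ofBond,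
        hu, seam_eq, zero_sub]
    · rw [hsupp x hx, hx.rev_val, hx.mem_iff, sub_self]

variable (s) in
theorem glue_isPlanar : s.glue.IsPlanar := by
  rintro f ⟨hf, hcurl⟩
  obtain ⟨g, hg, hfg⟩ := exists_potential_off_seam hf hcurl
  rw [← sub_add_cancel f (s.glue.grad g)]
  refine add_mem (mem_map_grad_of_off_seam (sub_mem hf (s.glue.grad_mem_antisymmetric g))
    (sub_mem hcurl fun h hh => dotProduct_grad_eq_zero hg hh) fun x hx => ?_) ⟨g, hg, rfl⟩
  rw [Pi.sub_apply, hfg x hx, sub_self]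

end Splice

end RotationSystem

/-! ### Annular diagrams -/

section OrbitWord

variable {α β κ : Type*} {π : Perm α} {ρ : Perm β} {l : α → κ} {m : β → κ} {a : α} {b : β}

/-- The word of the labels `l` read along the cycle of `a` under `π`, starting with `a`. -/
noncomputable def orbitWord (π : Perm α) (l : α → κ) (a : α) : List κ :=
  (List.range (Function.minimalPeriod π a)).map fun k => l (π^[k] a)

theorem length_orbitWord : (orbitWord π l a).length = Function.minimalPeriod π a := by
  simp [orbitWord]

theorem coe_orbitWord (π : Perm α) (l : α → κ) (a : α) :
    (orbitWord π l a : Cycle κ) = (Function.periodicOrbit π a).map l := by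
  rw [orbitWord, Function.periodicOrbit_def, Cycle.map_coe, List.map_map]
  rfl

theorem coe_orbitWord_eq_of_sameCycle [Finite α] {a' : α} (h : π.SameCycle a a') :
    (orbitWord π l a : Cycle κ) = orbitWord π l a' := by
  obtain ⟨n, -, rfl⟩ := exists_iterate_eq_of_sameCycle h
  rw [coe_orbitWord, coe_orbitWord,
    Function.periodicOrbit_apply_iterate_eq (π.injective.mem_periodicPts a)]

theorem orbitWord_eq_iff :
    orbitWord π l a = orbitWord ρ m b ↔
      Function.minimalPeriod π a = Function.minimalPeriod ρ b ∧
        ∀ k < Function.minimalPeriod π a, l (π^[k] a) = m (ρ^[k] b) := by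
  have length_eq (h : orbitWord π l a = orbitWord ρ m b) :
      Function.minimalPeriod π a = Function.minimalPeriod ρ b := by
    rw [← length_orbitWord (l := l), h, length_orbitWord]
  constructor
  · intro h
    refine ⟨length_eq h, fun k hk => ?_⟩
    rw [orbitWord, orbitWord, ← length_eq h, List.map_inj_left] at h
    exact h k (List.mem_range.2 hk)
  · rintro ⟨hp, hl⟩
    rw [orbitWord, orbitWord, ← hp, List.map_inj_left]
    exact fun k hk => hl k (List.mem_range.1 hk)

theorem orbitWord_eq_of_semiconj {f : α → β} (hf : f.Injective)
    (h : ∀ n, f (π^[n] a) = ρ^[n] (f a)) : orbitWord π (m ∘ f) a = orbitWord ρ m (f a) :=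
  orbitWord_eq_iff.2 ⟨Function.minimalPeriod_eq_minimalPeriod_iff.2 fun n => by
    rw [Function.IsPeriodicPt, Function.IsPeriodicPt, Function.IsFixedPt, Function.IsFixedPt, ← h,
      hf.eq_iff], fun n _ => congrArg m (h n)⟩

end OrbitWord

namespace SphereMap

variable {M : SphereMap}

instance : Finite M.Dart := M.finite_dart

instance : Nonempty M.Dart := M.nonempty_dart

instance : Finite M.Face := Quotient.finite _

variable (M) in
/-- The rotation system of a map on the sphere. -/
def toRotationSystem : RotationSystem M.Dart := ⟨M.rev, M.rot, M.rev_rev, M.rev_ne⟩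

theorem toRotationSystem_conn : M.toRotationSystem.Conn Set.univ := by
  obtain ⟨o⟩ : Nonempty M.Dart := inferInstance
  refine RotationSystem.conn_of_forall_saturated o fun T hT ho d _ => ?_
  have mem_iff : ∀ g ∈ Subgroup.closure {M.rev, M.rot}, ∀ d, g d ∈ T ↔ d ∈ T := by
    intro g hg
    induction hg using Subgroup.closure_induction with
    | mem g hg =>
      rcases hg with rfl | rfl
      · exact fun d => hT.2 d trivial trivial
      · exact hT.1
    | one => exact fun d => Iff.rfl
    | mul g h _ _ ihg ihh => exact fun d => (ihg _).trans (ihh d)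
    | inv g _ ih => exact fun d => by rw [← ih]; simp
  obtain ⟨g, hg, rfl⟩ := M.connected o d
  exact (mem_iff g hg o).2 ho

theorem toRotationSystem_isPlanar [Fintype M.Dart] : M.toRotationSystem.IsPlanar :=
  (RotationSystem.euler_iff_isPlanar toRotationSystem_conn).1 M.euler

theorem exists_face_eq (f : M.Face) : ∃ d, M.face d = f := Quotient.exists_rep f

theorem face_eq_iff {d e : M.Dart} : M.face d = M.face e ↔ M.next.SameCycle d e :=
  Quotient.eq (r := SameCycle.setoid M.next)

theorem tail_eq_iff {d e : M.Dart} : M.tail d = M.tail e ↔ M.rot.SameCycle d e :=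
  Quotient.eq (r := SameCycle.setoid M.rot)

theorem face_next (d : M.Dart) : M.face (M.next d) = M.face d :=
  face_eq_iff.2 (sameCycle_apply_left.2 (SameCycle.refl _ d))

end SphereMap

/-- A connected plane graph, as a map on the sphere. -/
def RotationSystem.toSphereMap {D : Type} [Fintype D] [Nonempty D] (G : RotationSystem D)
    (hc : G.Conn Set.univ) (hG : G.IsPlanar) : SphereMap where
  Dart := D
  finite_dart := inferInstance
  nonempty_dart := inferInstance
  rev := G.rev
  rev_rev := G.rev_rev
  rev_ne := G.rev_ne
  rot := G.rot
  connected d e := by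
    let orbit : Set D := {e | ∃ g ∈ Subgroup.closure {G.rev, G.rot}, g d = e}
    have apply_mem {g : Perm D} (hg : g ∈ ({G.rev, G.rot} : Set (Perm D))) (e : D) :
        g e ∈ orbit ↔ e ∈ orbit := by
      refine ⟨?_, ?_⟩ <;> rintro ⟨h, hh, he⟩
      · exact ⟨g⁻¹ * h, mul_mem (inv_mem (Subgroup.subset_closure hg)) hh, by simp [he]⟩
      · exact ⟨g * h, mul_mem (Subgroup.subset_closure hg) hh, by simp [he]⟩
    exact hc.subset (T := orbit) ⟨apply_mem (by simp), fun e _ _ => apply_mem (by simp) e⟩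
      (Set.mem_univ d) ⟨1, one_mem _, rfl⟩ (Set.mem_univ e)
  euler := (euler_iff_isPlanar hc).2 hG

namespace AnnularDiagram

open RotationSystem RotationSystem.Splice

variable {X : Type*} {R : Set (GroupWord X)} {Δ : AnnularDiagram R}

noncomputable instance : Fintype Δ.Dart := Fintype.ofFinite _

variable (Δ) in
/-- The word read along the contour of the face to the left of `d`, starting with `d`. -/
noncomputable def contourWord (d : Δ.Dart) : GroupWord X := orbitWord Δ.next Δ.label d

theorem contourLabel_eq_coe_contourWord (d : Δ.Dart) :
    Δ.contourLabel d = (Δ.contourWord d : Cycle (X × Bool)) :=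
  (coe_orbitWord Δ.next Δ.label d).symm

theorem contourLabel_eq_of_face_eq {d d' : Δ.Dart} (h : Δ.face d = Δ.face d') :
    Δ.contourLabel d = Δ.contourLabel d' := by
  rw [contourLabel_eq_coe_contourWord, contourLabel_eq_coe_contourWord]
  exact coe_orbitWord_eq_of_sameCycle (SphereMap.face_eq_iff.1 h)

theorem face_ne_of_mem_bond {S : Set Δ.Dart} (hS : Δ.toRotationSystem.Invariant S)
    (hin : ∀ d, Δ.face d = Δ.inner → d ∈ S) (hout : ∀ d, Δ.face d = Δ.outer → d ∉ S)
    {b : Δ.Dart} (hb : b ∈ Δ.toRotationSystem.bond S) :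
    Δ.face b ≠ Δ.inner ∧ Δ.face b ≠ Δ.outer :=
  ⟨fun h => hb.2 ((hS.next_mem_iff b).1 (hin _ ((SphereMap.face_next b).trans h))),
    fun h => hout b h hb.1⟩

variable (Δ) in
/-- Two nested cuts of a diagram, separating the holes, whose bonds are crossed by equally labelled
cells in the same pattern, but by no common cell. -/
structure Splice (S₁ S₂ : Set Δ.Dart) extends Δ.toRotationSystem.Splice S₁ S₂ where
  inner_mem : ∀ d, Δ.face d = Δ.inner → d ∈ S₁
  outer_notMem : ∀ d, Δ.face d = Δ.outer → d ∉ S₂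
  separated : ∀ x ∈ S₁, ∀ y ∉ S₂, Δ.face x ≠ Δ.face y
  contourWord_e : ∀ b, Δ.contourWord (e b).1 = Δ.contourWord b.1

namespace Splice

variable {S₁ S₂ : Set Δ.Dart} (s : Δ.Splice S₁ S₂)

theorem face_bond_ne (s : Δ.Splice S₁ S₂) (b : Δ.toRotationSystem.bond S₁) :
    Δ.face b.1 ≠ Δ.inner ∧ Δ.face b.1 ≠ Δ.outer :=
  face_ne_of_mem_bond s.cut₁.invariant s.inner_mem
    (fun d hd h => s.outer_notMem d hd (s.subset h)) b.2

theorem face_e_ne (b : Δ.toRotationSystem.bond S₁) :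
    Δ.face (s.e b).1 ≠ Δ.inner ∧ Δ.face (s.e b).1 ≠ Δ.outer :=
  face_ne_of_mem_bond s.cut₂.invariant (fun d hd => s.subset (s.inner_mem d hd)) s.outer_notMem
    (s.e b).2

theorem label_iterate_e (b : Δ.toRotationSystem.bond S₁) {k : ℕ}
    (hk : k < Function.minimalPeriod Δ.next b.1) :
    Δ.label (Δ.next^[k] (s.e b).1) = Δ.label (Δ.next^[k] b.1) :=
  ((orbitWord_eq_iff.1 (s.contourWord_e b)).2 k) (hk.trans_eq (s.period_e b).symm)

theorem label_e (b : Δ.toRotationSystem.bond S₁) : Δ.label (s.e b).1 = Δ.label b.1 :=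
  s.label_iterate_e b (minimalPeriod_next_pos (G := Δ.toRotationSystem) b.1)

theorem not_sameCycle_of_face {x : s.Dart} (hx : Δ.face x.1 = Δ.inner ∨ Δ.face x.1 = Δ.outer)
    (b : Δ.toRotationSystem.bond S₁) : ¬s.glue.next.SameCycle (s.ofBond b) x := by
  intro h
  rcases x.2 with hx₁ | hx₂
  · rw [← SphereMap.face_eq_iff.2 (sameCycle_of_mem h hx₁)] at hx
    exact hx.elim (s.face_bond_ne b).1 (s.face_bond_ne b).2
  · rw [← SphereMap.face_eq_iff.2 (sameCycle_of_notMem h hx₂)] at hx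
    exact hx.elim (s.face_e_ne b).1 (s.face_e_ne b).2

theorem orbitWord_ofBond (b : Δ.toRotationSystem.bond S₁) :
    orbitWord s.glue.next (fun x => Δ.label x.1) (s.ofBond b) = Δ.contourWord b.1 := by
  refine orbitWord_eq_iff.2 ⟨s.minimalPeriod_ofBond b, fun k hk => ?_⟩
  rw [s.minimalPeriod_ofBond] at hk
  rcases Nat.eq_zero_or_pos k with rfl | hpos
  · rfl
  rcases le_or_gt k (Δ.toRotationSystem.run S₁ b) with hrun | hrun
  · rw [s.iterate_next_of_le_run hpos hrun]
    exact s.label_iterate_e b hk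
  · rw [s.iterate_next_of_run_lt hrun hk.le]
    rfl

theorem orbitWord_of_forall {x : s.Dart} (hx : ∀ b, ¬s.glue.next.SameCycle (s.ofBond b) x) :
    orbitWord s.glue.next (fun x => Δ.label x.1) x = Δ.contourWord x.1 :=
  orbitWord_eq_of_semiconj (m := Δ.label) Subtype.val_injective (iterate_next_val hx)

noncomputable instance : Fintype s.Dart := Fintype.ofFinite _

instance : Nonempty s.Dart := ⟨s.ofBond ⟨_, s.nonempty.some_mem⟩⟩

/-- The underlying map of the spliced diagram. -/
noncomputable def map : SphereMap := s.glue.toSphereMap s.glue_conn s.glue_isPlanar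

/-- A dart on the contour of the inner hole. -/
noncomputable def innerDart : s.map.Dart :=
  ⟨(SphereMap.exists_face_eq Δ.inner).choose,
    Or.inl (s.inner_mem _ (SphereMap.exists_face_eq Δ.inner).choose_spec)⟩

/-- A dart on the contour of the outer hole. -/
noncomputable def outerDart : s.map.Dart :=
  ⟨(SphereMap.exists_face_eq Δ.outer).choose,
    Or.inr (s.outer_notMem _ (SphereMap.exists_face_eq Δ.outer).choose_spec)⟩

/-- A dart of the spliced diagram, as a dart of the original one. -/
def val (x : s.map.Dart) : Δ.Dart := Subtype.val (p := fun d => d ∈ S₁ ∨ d ∉ S₂) x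

variable {s} {x y : s.map.Dart}

theorem face_eq_iff_sameCycle :
    s.map.face x = s.map.face y ↔ s.glue.next.SameCycle x y := SphereMap.face_eq_iff

theorem face_innerDart : Δ.face (s.val s.innerDart) = Δ.inner :=
  (SphereMap.exists_face_eq Δ.inner).choose_spec

theorem face_outerDart : Δ.face (s.val s.outerDart) = Δ.outer :=
  (SphereMap.exists_face_eq Δ.outer).choose_spec

theorem face_eq_iff_face_val_eq
    (hx : ∀ b, ¬s.glue.next.SameCycle (s.ofBond b) x) :
    s.map.face x = s.map.face y ↔ Δ.face (s.val x) = Δ.face (s.val y) :=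
  face_eq_iff_sameCycle.trans ((sameCycle_iff_of_forall hx).trans SphereMap.face_eq_iff.symm)

theorem face_eq_inner_iff :
    s.map.face x = s.map.face s.innerDart ↔ Δ.face (s.val x) = Δ.inner := by
  rw [eq_comm, face_eq_iff_face_val_eq (s.not_sameCycle_of_face (Or.inl face_innerDart)),
    face_innerDart, eq_comm]

theorem face_eq_outer_iff :
    s.map.face x = s.map.face s.outerDart ↔ Δ.face (s.val x) = Δ.outer := by
  rw [eq_comm, face_eq_iff_face_val_eq (s.not_sameCycle_of_face (Or.inr face_outerDart)),
    face_outerDart, eq_comm]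

theorem label_rev_val (x : s.map.Dart) :
    Δ.label (s.val (s.map.rev x)) = ((Δ.label (s.val x)).1, !(Δ.label (s.val x)).2) := by
  rcases s.seam_cases x with ⟨b, rfl⟩ | ⟨b, rfl⟩ | hx
  · have rev_eq : s.val (s.map.rev (s.ofBond b)) = Δ.rev (s.e b).1 :=
      congrArg s.val (s.rev_ofBond b)
    rw [rev_eq, Δ.label_rev, s.label_e]
    rfl
  · have rev_eq : s.val (s.map.rev (s.ofRevBond b)) = b.1 := congrArg s.val (s.rev_ofRevBond b)
    have val_eq : s.val (s.ofRevBond b) = Δ.rev (s.e b).1 := rfl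
    rw [rev_eq, val_eq, Δ.label_rev, s.label_e]
    simp
  · have rev_eq : s.val (s.map.rev x) = Δ.rev (s.val x) := hx.rev_val
    rw [rev_eq, Δ.label_rev]

theorem exists_contourLabel_eq (hinner : s.map.face x ≠ s.map.face s.innerDart)
    (houter : s.map.face x ≠ s.map.face s.outerDart) :
    ∃ d, Δ.face d ≠ Δ.inner ∧ Δ.face d ≠ Δ.outer ∧
      (Function.periodicOrbit s.map.next x).map (fun y => Δ.label (s.val y)) =
        Δ.contourLabel d := by
  by_cases hb : ∃ b, s.glue.next.SameCycle (s.ofBond b) x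
  · obtain ⟨b, hb⟩ := hb
    refine ⟨b.1, (s.face_bond_ne b).1, (s.face_bond_ne b).2, ?_⟩
    rw [contourLabel_eq_coe_contourWord, ← s.orbitWord_ofBond, coe_orbitWord_eq_of_sameCycle hb]
    exact (coe_orbitWord s.glue.next _ x).symm
  · refine ⟨s.val x, fun h => hinner (face_eq_inner_iff.2 h),
      fun h => houter (face_eq_outer_iff.2 h), ?_⟩
    rw [contourLabel_eq_coe_contourWord, val, ← s.orbitWord_of_forall (not_exists.1 hb)]
    exact (coe_orbitWord s.glue.next _ x).symm

variable (s) in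
/-- The diagram obtained by cutting out the part between the two bonds. -/
noncomputable def diagram : AnnularDiagram R where
  toSphereMap := s.map
  label x := Δ.label (s.val x)
  label_rev := label_rev_val
  inner := s.map.face s.innerDart
  outer := s.map.face s.outerDart
  inner_ne_outer h := Δ.inner_ne_outer (by rwa [face_eq_outer_iff, face_innerDart] at h)
  cell_label x hinner houter := by
    obtain ⟨d, hd, hd', h⟩ := exists_contourLabel_eq hinner houter
    rw [h]
    exact Δ.cell_label d hd hd'

theorem contourLabel_diagram (hx : Δ.face (s.val x) = Δ.inner ∨ Δ.face (s.val x) = Δ.outer) :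
    s.diagram.contourLabel x = Δ.contourLabel (s.val x) := by
  refine (contourLabel_eq_coe_contourWord (Δ := s.diagram) x).trans ?_
  rw [contourLabel_eq_coe_contourWord]
  exact congrArg _ (s.orbitWord_of_forall (s.not_sameCycle_of_face hx))

variable (s)

theorem sameBoundaryLabels : Δ.SameBoundaryLabels s.diagram := by
  constructor <;> intro d x hd hx
  · have hx' := face_eq_inner_iff.1 hx
    exact (contourLabel_eq_of_face_eq (hd.trans hx'.symm)).trans
      (contourLabel_diagram (Or.inl hx')).symm
  · have hx' := face_eq_outer_iff.1 hx
    exact (contourLabel_eq_of_face_eq (hd.trans hx'.symm)).trans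
      (contourLabel_diagram (Or.inr hx')).symm

variable {s}

theorem tail_val_eq (h : s.map.tail x = s.map.tail y) : Δ.tail (s.val x) = Δ.tail (s.val y) :=
  eq_of_sameCycle (h := fun x => Δ.tail (s.val x))
    (fun x => SphereMap.tail_eq_iff.2 <|
      (congrArg (Δ.rot.SameCycle · x.1) (s.rot_val x)).mpr (SameCycle.refl Δ.rot _).apply_left)
    (SphereMap.tail_eq_iff.1 h)

theorem isProper (h : Δ.IsProper) : s.diagram.IsProper := by
  obtain ⟨simple_inner, simple_outer, disjoint⟩ := h
  refine ⟨fun x y hx hy hxy => Subtype.ext ?_, fun x y hx hy hxy => Subtype.ext ?_, ?_⟩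
  · exact simple_inner _ _ (face_eq_inner_iff.1 hx) (face_eq_inner_iff.1 hy) (tail_val_eq hxy)
  · exact simple_outer _ _ (face_eq_outer_iff.1 hx) (face_eq_outer_iff.1 hy) (tail_val_eq hxy)
  · rintro v ⟨⟨x, rfl, hx⟩, ⟨y, hxy, hy⟩⟩
    exact disjoint _
      ⟨⟨_, rfl, face_eq_inner_iff.1 hx⟩, ⟨_, tail_val_eq hxy, face_eq_outer_iff.1 hy⟩⟩

/-- A dart whose face in the original diagram can stand for its face in the spliced diagram: for a
face that crosses the seam we choose the side of the inner hole. -/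
def IsRepresentative (x : s.map.Dart) : Prop :=
  s.val x ∉ S₁ → ∀ b, ¬s.glue.next.SameCycle (s.ofBond b) x

theorem exists_isRepresentative (f : s.map.Face) :
    ∃ x : s.map.Dart, s.map.face x = f ∧ IsRepresentative x := by
  obtain ⟨x, rfl⟩ := SphereMap.exists_face_eq f
  by_cases hb : ∃ b, s.glue.next.SameCycle (s.ofBond b) x
  · obtain ⟨b, hb⟩ := hb
    exact ⟨s.ofBond b, face_eq_iff_sameCycle.2 hb, fun h => absurd (s.ofBond_mem b) h⟩
  · exact ⟨x, rfl, fun _ => not_exists.1 hb⟩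

theorem IsRepresentative.face_eq (hx : IsRepresentative x)
    (h : Δ.face (s.val x) = Δ.face (s.val y)) : s.map.face x = s.map.face y := by
  by_cases hx₁ : s.val x ∈ S₁ <;> by_cases hy₁ : s.val y ∈ S₁
  · exact face_eq_iff_sameCycle.2 (sameCycle_of_mem_mem hx₁ hy₁ (SphereMap.face_eq_iff.1 h))
  · exact absurd h (s.separated _ hx₁ _ (y.2.resolve_left hy₁))
  · exact absurd h.symm (s.separated _ hy₁ _ (x.2.resolve_left hx₁))
  · exact (face_eq_iff_face_val_eq (hx hx₁)).2 h

theorem IsRepresentative.face_val_ne (hx : IsRepresentative x)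
    (b : Δ.toRotationSystem.bond S₁) : Δ.face (s.val x) ≠ Δ.face (s.e b).1 := by
  intro h
  by_cases hx₁ : s.val x ∈ S₁
  · refine s.separated _ hx₁ (Δ.next (s.e b).1) (fun hmem => (s.e b).2.2 ?_)
      (h.trans (SphereMap.face_next _).symm)
    exact (s.cut₂.invariant.next_mem_iff _).1 hmem
  · exact hx hx₁ b
      (sameCycle_ofBond_of_notMem (x.2.resolve_left hx₁) (SphereMap.face_eq_iff.1 h.symm))

variable (s)

theorem area_lt : s.diagram.area < Δ.area := by
  choose rep face_rep isRepresentative_rep using exists_isRepresentative (s := s)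
  let cell : {f : s.diagram.Face // f ≠ s.diagram.inner ∧ f ≠ s.diagram.outer} →
      {f : Δ.Face // f ≠ Δ.inner ∧ f ≠ Δ.outer} := fun f =>
    ⟨Δ.face (s.val (rep f.1)),
      fun h => f.2.1 ((face_rep f.1).symm.trans (face_eq_inner_iff.2 h)),
      fun h => f.2.2 ((face_rep f.1).symm.trans (face_eq_outer_iff.2 h))⟩
  have injective : cell.Injective := fun f f' h => Subtype.ext <| by
    rw [← face_rep f.1, ← face_rep f'.1]
    exact (isRepresentative_rep f.1).face_eq (congrArg Subtype.val h)
  have not_surjective : ¬cell.Surjective := fun h => by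
    obtain ⟨f, hf⟩ := h ⟨Δ.face (s.e ⟨_, s.nonempty.some_mem⟩).1, s.face_e_ne _⟩
    exact (isRepresentative_rep f.1).face_val_ne _ (congrArg Subtype.val hf)
  have := Fintype.ofFinite Δ.Face
  have := Fintype.ofFinite s.diagram.Face
  classical
  rw [area, area, Nat.card_eq_fintype_card, Nat.card_eq_fintype_card]
  exact Fintype.card_lt_of_injective_not_surjective cell injective not_surjective

theorem not_isMinimal (s : Δ.Splice S₁ S₂) : ¬(Δ.IsMinimal ∨ Δ.IsMinimalProper) := by
  rintro (hmin | ⟨hproper, hmin⟩)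
  · exact s.area_lt.not_ge (hmin _ s.sameBoundaryLabels)
  · exact s.area_lt.not_ge (hmin _ (isProper hproper) s.sameBoundaryLabels)

end Splice

end AnnularDiagram

/-! ### Level curves -/

namespace RotationSystem

variable {D : Type*} {G : RotationSystem D} {S S' T I : Set D} {a b d o : D}

theorem Saturated.anti (hT : G.Saturated S' T) (h : S ⊆ S') : G.Saturated S T :=
  ⟨hT.1, fun d hd hd' => hT.2 d (h hd) (h hd')⟩

theorem Saturated.inter (hS' : G.Saturated S S') (hT : G.Saturated S' T) :
    G.Saturated S (T ∩ S') := by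
  refine ⟨fun d => and_congr (hT.1 d) (hS'.1 d), fun d hd hrev => ?_⟩
  have mem_iff := hS'.2 d hd hrev
  by_cases hd' : d ∈ S'
  · exact and_congr (hT.2 d hd' (mem_iff.2 hd')) mem_iff
  · exact iff_of_false (fun h => hd' (mem_iff.1 h.2)) fun h => hd' h.2

theorem Saturated.mem_of_sameCycle_next [Finite D] (hT : G.Saturated S T) (hS : G.Invariant S)
    (hface : ∀ c, G.next.SameCycle a c → c ∈ S) (ha : a ∈ T) (hab : G.next.SameCycle a b) :
    b ∈ T := by
  obtain ⟨n, -, rfl⟩ := exists_iterate_eq_of_sameCycle hab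
  clear hab
  induction n with
  | zero => exact ha
  | succ n ih =>
    have next_mem : G.next (G.next^[n] a) ∈ S := by
      rw [← Function.iterate_succ_apply' G.next]
      exact hface _ (sameCycle_iterate _ _ _)
    rw [Function.iterate_succ_apply', hT.1.next_mem_iff]
    exact (hT.2 _ (hface _ (sameCycle_iterate _ _ _)) ((hS.next_mem_iff _).1 next_mem)).2 ih

theorem Conn.extend (hS : G.Conn S) (hS' : G.Invariant S') (hSS' : S ⊆ S')
    (h : ∀ d ∈ S', d ∈ S ∨ ∃ e, G.rot.SameCycle e d ∧ G.rev e ∈ S) : G.Conn S' := by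
  have subset_of_subset {T : Set D} (hT : G.Saturated S' T) (hST : S ⊆ T) : S' ⊆ T := by
    intro d hd
    rcases h d hd with hdS | ⟨e, hed, heS⟩
    · exact hST hdS
    · have heS' : e ∈ S' := (hS'.mem_iff_of_sameCycle hed).2 hd
      exact (hT.1.mem_iff_of_sameCycle hed).1 ((hT.2 e heS' (hSS' heS)).1 (hST heS))
  exact fun T hT => (hS T (hT.anti hSS')).imp (subset_of_subset hT) (subset_of_subset hT.compl)

theorem exists_mem_bond_of_sameCycle [Finite D] (hS : G.Invariant S) (ha : a ∈ S) (hb : b ∉ S)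
    (hab : G.next.SameCycle a b) : ∃ d ∈ G.bond S, G.next.SameCycle a d := by
  by_contra! h
  obtain ⟨n, -, rfl⟩ := exists_iterate_eq_of_sameCycle hab
  clear hab
  refine hb ?_
  clear hb
  induction n with
  | zero => exact ha
  | succ n ih =>
    rw [Function.iterate_succ_apply', hS.next_mem_iff]
    exact not_not.1 fun hrev => h _ ⟨ih, hrev⟩ (sameCycle_iterate _ _ _)

theorem bond_nonempty (hc : G.Conn Set.univ) (hS : G.Invariant S) (ha : a ∈ S) (hb : b ∉ S) :
    (G.bond S).Nonempty := by
  by_contra hempty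
  rw [Set.not_nonempty_iff_eq_empty, Set.eq_empty_iff_forall_notMem] at hempty
  refine hb (hc.subset ⟨hS, fun d _ _ => ⟨fun hd => ?_, fun hd => ?_⟩⟩ (Set.mem_univ a) ha
    (Set.mem_univ b))
  · exact not_not.1 fun h => hempty (G.rev d) ⟨hd, by rwa [G.rev_rev]⟩
  · exact not_not.1 fun h => hempty d ⟨hd, h⟩

variable (G) in
/-- The union of the connected components meeting `I` of the subgraph spanned by the vertices in
`S`, where `I` should be contained in `S`. -/
def component (S I : Set D) : Set D := {d | ∀ T, G.Saturated S T → I ⊆ T → d ∈ T}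

theorem subset_component : I ⊆ G.component S I := fun _ hd _ _ hI => hI hd

theorem component_saturated : G.Saturated S (G.component S I) :=
  ⟨fun d => forall₃_congr fun _ hT _ => hT.1 d,
    fun d hd hd' => forall₃_congr fun _ hT _ => hT.2 d hd hd'⟩

theorem component_subset (hS : G.Invariant S) (hI : I ⊆ S) : G.component S I ⊆ S :=
  fun _ hd => hd S ⟨hS, fun _ h h' => iff_of_true h' h⟩ hI

theorem component_mono (h : S ⊆ S') : G.component S I ⊆ G.component S' I :=
  fun _ hd T hT hI => hd T (hT.anti h) hI

theorem rev_notMem_of_mem_bond_component (hS : G.Invariant S) (hI : I ⊆ S)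
    (hd : d ∈ G.bond (G.component S I)) : G.rev d ∉ S := fun h =>
  hd.2 ((component_saturated.2 d (component_subset hS hI hd.1) h).2 hd.1)

theorem component_conn [Finite D] (hI : ∀ a ∈ I, ∀ b, G.next.SameCycle a b ↔ b ∈ I) :
    G.Conn (G.component S I) := by
  obtain rfl | ⟨o, ho⟩ := I.eq_empty_or_nonempty
  · exact fun T _ => Or.inl fun d hd =>
      absurd (hd ∅ ⟨fun _ => Iff.rfl, fun _ _ _ => Iff.rfl⟩ subset_rfl) (Set.notMem_empty d)
  refine conn_of_forall_saturated o fun T hT hoT d hd => ?_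
  refine (hd _ (component_saturated.inter hT) fun a ha => ⟨?_, subset_component ha⟩).1
  exact hT.mem_of_sameCycle_next component_saturated.1
    (fun c hc => subset_component ((hI o ho c).1 hc)) hoT ((hI o ho a).2 ha)

theorem component_compl_conn (hc : G.Conn Set.univ) (hS : G.Invariant S) (hSc : G.Conn Sᶜ)
    (hI : I ⊆ S) (hne : I.Nonempty) : G.Conn (G.component S I)ᶜ := by
  have compl_subset : Sᶜ ⊆ (G.component S I)ᶜ :=
    Set.compl_subset_compl.2 (component_subset hS hI)
  have subset_of_subset {T : Set D} (hT : G.Saturated (G.component S I)ᶜ T) (hST : Sᶜ ⊆ T) :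
      (G.component S I)ᶜ ⊆ T := by
    have rev_mem (d : D) (hd : d ∈ T ∪ G.component S I) : G.rev d ∈ T ∪ G.component S I := by
      by_cases hrev : G.rev d ∈ G.component S I
      · exact Or.inr hrev
      by_cases hdC : d ∈ G.component S I
      · exact Or.inl (hST (rev_notMem_of_mem_bond_component hS hI ⟨hdC, hrev⟩))
      · exact Or.inl ((hT.2 d hdC hrev).2 (hd.resolve_right hdC))
    have saturated_union : G.Saturated Set.univ (T ∪ G.component S I) :=
      ⟨fun d => or_congr (hT.1 d) (component_saturated.1 d), fun d _ _ =>
        ⟨fun h => G.rev_rev d ▸ rev_mem _ h, rev_mem d⟩⟩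
    obtain ⟨o, ho⟩ := hne
    exact fun d hd => (hc.subset saturated_union (Set.mem_univ o) (Or.inr (subset_component ho))
      (Set.mem_univ d)).resolve_right hd
  exact fun T hT =>
    (hSc T (hT.anti compl_subset)).imp (subset_of_subset hT) (subset_of_subset hT.compl)

end RotationSystem

/-- The darts on the contour of a face, which lies to their left. -/
def SphereMap.contour (M : SphereMap) (f : M.Face) : Set M.Dart := {d | M.face d = f}

namespace SphereMap

variable {M : SphereMap} {f : M.Face}

theorem contour_nonempty (f : M.Face) : (M.contour f).Nonempty := exists_face_eq f

theorem sameCycle_iff_mem_contour {a : M.Dart} (ha : a ∈ M.contour f) (b : M.Dart) :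
    M.next.SameCycle a b ↔ b ∈ M.contour f := by
  rw [← face_eq_iff, show M.face a = f from ha, eq_comm]
  rfl

end SphereMap

namespace AnnularDiagram

open RotationSystem

variable {X : Type*} {R : Set (GroupWord X)} {Δ : AnnularDiagram R}

variable (Δ) in
/-- The darts leaving the vertices at distance at most `i` from the outer boundary component. -/
def outerBall : ℕ → Set Δ.Dart
  | 0 => {d | Δ.OnContour (Δ.tail d) Δ.outer}
  | i + 1 => {d | d ∈ outerBall i ∨ ∃ e, Δ.tail e = Δ.tail d ∧ Δ.rev e ∈ outerBall i}

variable (Δ) in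
/-- The darts leaving the vertices that can be reached from the inner boundary component without
meeting a vertex at distance at most `i` from the outer one. -/
def innerSide (i : ℕ) : Set Δ.Dart :=
  Δ.toRotationSystem.component (Δ.outerBall i)ᶜ (Δ.contour Δ.inner)

variable {d : Δ.Dart} {i j k L : ℕ}

theorem outerBall_mono : Monotone Δ.outerBall := monotone_nat_of_le_succ fun _ _ => Or.inl

theorem outerBall_invariant (i : ℕ) : Δ.toRotationSystem.Invariant (Δ.outerBall i) := by
  have tail_rot (d : Δ.Dart) : Δ.tail (Δ.toRotationSystem.rot d) = Δ.tail d :=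
    SphereMap.tail_eq_iff.2 (sameCycle_apply_left.2 (SameCycle.refl _ d))
  induction i with
  | zero => exact fun d => by simp only [outerBall, Set.mem_ofPred_eq, tail_rot]
  | succ i ih =>
    exact fun d => or_congr (ih d) (by simp only [tail_rot])

theorem mem_outerBall_of_mem_contour (h : d ∈ Δ.contour Δ.outer) (i : ℕ) : d ∈ Δ.outerBall i :=
  outerBall_mono (Nat.zero_le i) ⟨d, rfl, h⟩

theorem mem_outerBall_succ_of_rev_mem (h : Δ.rev d ∈ Δ.outerBall i) : d ∈ Δ.outerBall (i + 1) :=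
  Or.inr ⟨d, rfl, h⟩

theorem mem_outerBall_of_iterate_next_mem (h : Δ.toRotationSystem.next^[k] d ∈ Δ.outerBall i) :
    d ∈ Δ.outerBall (i + k) := by
  induction k generalizing d with
  | zero => exact h
  | succ k ih =>
    exact mem_outerBall_succ_of_rev_mem (((outerBall_invariant _).next_mem_iff d).1 (ih h))

theorem exists_isPath_of_mem_outerBall (h : d ∈ Δ.outerBall i) :
    ∃ w y, Δ.OnContour w Δ.outer ∧ Δ.IsPath (Δ.tail d) w y ∧ y.length ≤ i := by
  induction i generalizing d with
  | zero => exact ⟨Δ.tail d, [], h, rfl, le_rfl⟩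
  | succ i ih =>
    rcases h with h | ⟨e, hed, he⟩
    · obtain ⟨w, y, hw, hy, hlen⟩ := ih h
      exact ⟨w, y, hw, hy, hlen.trans i.le_succ⟩
    · obtain ⟨w, y, hw, hy, hlen⟩ := ih he
      exact ⟨w, e :: y, hw, ⟨hed, hy⟩, Nat.succ_le_succ hlen⟩

theorem contour_inner_subset_of_isShortestConnecting {x : List Δ.Dart}
    (hx : Δ.IsShortestConnecting x) (hi : i < x.length) :
    Δ.contour Δ.inner ⊆ (Δ.outerBall i)ᶜ := fun d hd h => by
  obtain ⟨w, y, hw, hy, hlen⟩ := exists_isPath_of_mem_outerBall h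
  exact absurd (hx.2 y ⟨Δ.tail d, w, ⟨d, rfl, hd⟩, hw, hy⟩) (by omega)

theorem outerBall_conn (i : ℕ) : Δ.toRotationSystem.Conn (Δ.outerBall i) := by
  induction i with
  | zero =>
    obtain ⟨o, ho⟩ := Δ.contour_nonempty Δ.outer
    refine conn_of_forall_saturated o fun T hT hoT d ⟨e, hed, he⟩ => ?_
    refine (hT.1.mem_iff_of_sameCycle (SphereMap.tail_eq_iff.1 hed)).1 ?_
    exact hT.mem_of_sameCycle_next (outerBall_invariant 0)
      (fun c hc => mem_outerBall_of_mem_contour ((SphereMap.sameCycle_iff_mem_contour ho c).1 hc) 0)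
      hoT ((SphereMap.sameCycle_iff_mem_contour ho e).2 he)
  | succ i ih =>
    exact ih.extend (outerBall_invariant _) (outerBall_mono i.le_succ) fun d hd =>
      hd.imp id fun ⟨e, hed, he⟩ => ⟨e, SphereMap.tail_eq_iff.1 hed, he⟩

theorem innerSide_invariant (i : ℕ) : Δ.toRotationSystem.Invariant (Δ.innerSide i) :=
  component_saturated.1

theorem innerSide_anti : Antitone Δ.innerSide := fun _ _ h =>
  component_mono (Set.compl_subset_compl.2 (outerBall_mono h))

theorem contour_inner_subset_innerSide (i : ℕ) : Δ.contour Δ.inner ⊆ Δ.innerSide i :=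
  subset_component

section Level

variable (hi : Δ.contour Δ.inner ⊆ (Δ.outerBall i)ᶜ) (hj : Δ.contour Δ.inner ⊆ (Δ.outerBall j)ᶜ)

include hi

theorem innerSide_subset : Δ.innerSide i ⊆ (Δ.outerBall i)ᶜ :=
  component_subset (outerBall_invariant i).compl hi

theorem notMem_innerSide_of_mem_contour (hd : d ∈ Δ.contour Δ.outer) : d ∉ Δ.innerSide i :=
  fun h => innerSide_subset hi h (mem_outerBall_of_mem_contour hd i)

theorem isCut_innerSide : Δ.toRotationSystem.IsCut (Δ.innerSide i) where
  invariant := innerSide_invariant i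
  conn := component_conn fun _ => SphereMap.sameCycle_iff_mem_contour
  conn_compl := component_compl_conn SphereMap.toRotationSystem_conn (outerBall_invariant i).compl
    (by rw [compl_compl]; exact outerBall_conn i) hi (Δ.contour_nonempty _)

theorem bond_innerSide_nonempty : (Δ.toRotationSystem.bond (Δ.innerSide i)).Nonempty := by
  obtain ⟨a, ha⟩ := Δ.contour_nonempty Δ.inner
  obtain ⟨b, hb⟩ := Δ.contour_nonempty Δ.outer
  exact bond_nonempty SphereMap.toRotationSystem_conn (innerSide_invariant i)
    (contour_inner_subset_innerSide i ha) (notMem_innerSide_of_mem_contour hi hb)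

theorem face_ne_of_mem_bond_innerSide (hd : d ∈ Δ.toRotationSystem.bond (Δ.innerSide i)) :
    Δ.face d ≠ Δ.inner ∧ Δ.face d ≠ Δ.outer :=
  face_ne_of_mem_bond (innerSide_invariant i) (contour_inner_subset_innerSide i)
    (fun _ => notMem_innerSide_of_mem_contour hi) hd

theorem rev_mem_outerBall_of_mem_bond (hd : d ∈ Δ.toRotationSystem.bond (Δ.innerSide i)) :
    Δ.rev d ∈ Δ.outerBall i :=
  not_not.1 (rev_notMem_of_mem_bond_component (outerBall_invariant i).compl hi hd)

omit hi
include hj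

theorem disjoint_bond_innerSide (hij : i < j) :
    Disjoint (Δ.toRotationSystem.bond (Δ.innerSide i))
      (Δ.toRotationSystem.bond (Δ.innerSide j)) := by
  have hi := hj.trans (Set.compl_subset_compl.2 (outerBall_mono hij.le))
  exact Set.disjoint_left.2 fun d hdi hdj => innerSide_subset hj hdj.1
    (outerBall_mono hij (mem_outerBall_succ_of_rev_mem (rev_mem_outerBall_of_mem_bond hi hdi)))

/- The contour of a cell is too short to lead from the inner side of level `i + L` to a vertex of
level `i`. -/
theorem face_ne_of_mem_innerSide_of_notMem_innerSide
    (hL : ∀ d, Δ.face d ≠ Δ.inner → Δ.face d ≠ Δ.outer → Function.minimalPeriod Δ.next d ≤ L)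
    (hij : i + L ≤ j) {a b : Δ.Dart} (ha : a ∈ Δ.innerSide j) (hb : b ∉ Δ.innerSide i) :
    Δ.face a ≠ Δ.face b := by
  intro hab
  have i_le_j : i ≤ j := (i.le_add_right L).trans hij
  have hi := hj.trans (Set.compl_subset_compl.2 (outerBall_mono i_le_j))
  have ha_ne_inner : Δ.face a ≠ Δ.inner := fun h =>
    hb (contour_inner_subset_innerSide i (hab.symm.trans h))
  have ha_ne_outer : Δ.face a ≠ Δ.outer := fun h => notMem_innerSide_of_mem_contour hj h ha
  obtain ⟨e, he, hae⟩ := exists_mem_bond_of_sameCycle (innerSide_invariant i)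
    (innerSide_anti i_le_j ha) hb (SphereMap.face_eq_iff.1 hab)
  have next_mem : Δ.next e ∈ Δ.outerBall i :=
    ((outerBall_invariant i).next_mem_iff e).2 (rev_mem_outerBall_of_mem_bond hi he)
  obtain ⟨k, hk, hke⟩ := exists_iterate_eq_of_sameCycle (sameCycle_apply_right.2 hae)
  refine innerSide_subset hj ha (outerBall_mono ?_ (mem_outerBall_of_iterate_next_mem
    (Set.mem_of_eq_of_mem hke next_mem)))
  have k_lt_L : k < L := hk.trans_le (hL a ha_ne_inner ha_ne_outer)
  omega

end Level

variable (R) in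
/-- The words that can be read along the contour of a cell. -/
def cellWords : Set (GroupWord X) :=
  {w | ∃ r ∈ R, (w : Cycle (X × Bool)) = r ∨ (w : Cycle (X × Bool)) = FreeGroup.invRev r}

theorem finite_cellWords (hR : R.Finite) : (cellWords R).Finite := by
  have finite_readings (r : GroupWord X) :
      {w : GroupWord X | (w : Cycle (X × Bool)) = r}.Finite :=
    r.cyclicPermutations.finite_toSet.subset fun w hw =>
      List.mem_cyclicPermutations_iff.2 (Cycle.coe_eq_coe.1 hw)
  refine (hR.biUnion fun r _ =>
    (finite_readings r).union (finite_readings (FreeGroup.invRev r))).subset ?_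
  rintro w ⟨r, hr, hw⟩
  exact Set.mem_biUnion hr hw

theorem contourWord_mem_cellWords (hinner : Δ.face d ≠ Δ.inner) (houter : Δ.face d ≠ Δ.outer) :
    Δ.contourWord d ∈ cellWords R := by
  rw [cellWords, Set.mem_ofPred_eq, ← contourLabel_eq_coe_contourWord]
  exact Δ.cell_label d hinner houter

theorem minimalPeriod_le (hL : ∀ w ∈ cellWords R, w.length ≤ L) (hinner : Δ.face d ≠ Δ.inner)
    (houter : Δ.face d ≠ Δ.outer) : Function.minimalPeriod Δ.next d ≤ L :=
  length_orbitWord.symm.trans_le (hL _ (contourWord_mem_cellWords hinner houter))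

theorem card_le_mul_area (hL : ∀ w ∈ cellWords R, w.length ≤ L) (s : Finset Δ.Dart)
    (hs : ∀ d ∈ s, Δ.face d ≠ Δ.inner ∧ Δ.face d ≠ Δ.outer) : s.card ≤ L * Δ.area := by
  classical
  have := Fintype.ofFinite Δ.Face
  have card_le_card_image : s.card ≤ L * (s.image Δ.face).card := by
    refine Finset.card_le_mul_card_image s L fun f hf => ?_
    obtain ⟨d, hd, rfl⟩ := Finset.mem_image.1 hf
    calc _ ≤ ((Finset.range (Function.minimalPeriod Δ.next d)).image (Δ.next^[·] d)).card := by
          refine Finset.card_le_card fun e he => ?_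
          obtain ⟨k, hk, hke⟩ := exists_iterate_eq_of_sameCycle
            (SphereMap.face_eq_iff.1 (Finset.mem_filter.1 he).2.symm)
          exact Finset.mem_image.2 ⟨k, Finset.mem_range.2 hk, hke⟩
      _ ≤ Function.minimalPeriod Δ.next d := Finset.card_image_le.trans_eq (Finset.card_range _)
      _ ≤ L := minimalPeriod_le hL (hs d hd).1 (hs d hd).2
  refine card_le_card_image.trans (Nat.mul_le_mul_left L ?_)
  rw [area, Nat.card_eq_fintype_card, Fintype.card_subtype]
  refine Finset.card_le_card fun f hf => ?_
  obtain ⟨d, hd, rfl⟩ := Finset.mem_image.1 hf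
  simpa using hs d hd

end AnnularDiagram

/-! ### Counting words -/

theorem card_filter_length_eq_le {κ : Type*} [Fintype κ] (I : Finset (List κ)) (t : ℕ) :
    (I.filter (·.length = t)).card ≤ Fintype.card κ ^ t := by
  classical
  rw [← card_vector t, ← Finset.card_univ]
  refine (Finset.card_le_card fun v hv => ?_).trans
    (Finset.card_image_le (f := List.Vector.toList))
  exact Finset.mem_image.2 ⟨⟨v, (Finset.mem_filter.1 hv).2⟩, Finset.mem_univ _, rfl⟩

/- The factor `2` replaces the prefix-freeness of Kraft's inequality: the words of length `t`
together contribute at most `2⁻ᵗ`. -/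
theorem sum_inv_two_mul_card_pow_length_le_one {κ : Type*} [Fintype κ] {I : Finset (List κ)}
    (hI : [] ∉ I) : ∑ w ∈ I, (2 * Fintype.card κ : ℝ)⁻¹ ^ w.length ≤ 1 := by
  have length_mem (w : List κ) (hw : w ∈ I) :
      w.length ∈ Finset.Ico 1 (I.sup List.length + 1) :=
    Finset.mem_Ico.2 ⟨List.length_pos_iff.2 (ne_of_mem_of_not_mem hw hI),
      Nat.lt_succ_of_le (Finset.le_sup (f := List.length) hw)⟩
  have sum_of_length_eq (t : ℕ) :
      ∑ w ∈ I with w.length = t, (2 * Fintype.card κ : ℝ)⁻¹ ^ w.length ≤ (1 / 2 : ℝ) ^ t := by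
    calc ∑ w ∈ I with w.length = t, (2 * Fintype.card κ : ℝ)⁻¹ ^ w.length
        = (I.filter (·.length = t)).card * (2 * Fintype.card κ : ℝ)⁻¹ ^ t := by
          rw [← nsmul_eq_mul]
          exact Finset.sum_eq_card_nsmul fun w hw => by rw [(Finset.mem_filter.1 hw).2]
      _ ≤ (Fintype.card κ : ℝ) ^ t * (2 * Fintype.card κ : ℝ)⁻¹ ^ t := by
          gcongr
          exact_mod_cast card_filter_length_eq_le I t
      _ = ((Fintype.card κ : ℝ) * (Fintype.card κ : ℝ)⁻¹ * (1 / 2)) ^ t := by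
          rw [← mul_pow]
          ring
      _ ≤ (1 / 2) ^ t := by
          gcongr
          linarith [mul_inv_le_one (a := (Fintype.card κ : ℝ))]
  rw [← Finset.sum_fiberwise_of_maps_to length_mem]
  calc _ ≤ ∑ t ∈ Finset.Ico 1 (I.sup List.length + 1), (1 / 2 : ℝ) ^ t :=
        Finset.sum_le_sum fun t _ => sum_of_length_eq t
    _ ≤ (1 / 2) ^ 1 / (1 - 1 / 2) := geom_sum_Ico_le_of_lt_one (by norm_num) (by norm_num)
    _ = 1 := by norm_num

theorem card_mul_log_card_le_sum_length {κ : Type*} [Fintype κ] {I : Finset (List κ)}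
    (hI : [] ∉ I) :
    (I.card : ℝ) * Real.log I.card ≤
      Real.log (2 * Fintype.card κ : ℕ) * (∑ w ∈ I, w.length : ℕ) := by
  obtain rfl | ⟨v, hv⟩ := I.eq_empty_or_nonempty
  · simp
  have card_pos : (0 : ℝ) < I.card := mod_cast Finset.card_pos.2 ⟨v, hv⟩
  have : Nonempty κ := ⟨v.head (ne_of_mem_of_not_mem hv hI)⟩
  push_cast
  set c := Real.log (2 * Fintype.card κ)
  have one_add_le (w : List κ) : 1 + Real.log I.card - c * w.length ≤
      I.card * (2 * Fintype.card κ : ℝ)⁻¹ ^ w.length := by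
    calc 1 + Real.log I.card - c * w.length
        = Real.log I.card - c * w.length + 1 := by ring
      _ ≤ Real.exp (Real.log I.card - c * w.length) := Real.add_one_le_exp _
      _ = I.card * (2 * Fintype.card κ : ℝ)⁻¹ ^ w.length := by
          rw [Real.exp_sub, Real.exp_log card_pos, mul_comm c, Real.exp_nat_mul,
            Real.exp_log (by positivity), inv_pow, div_eq_mul_inv]
  have sum_le : ∑ w ∈ I, (1 + Real.log I.card - c * w.length) ≤ I.card := by
    refine (Finset.sum_le_sum fun w _ => one_add_le w).trans ?_
    rw [← Finset.mul_sum]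
    exact mul_le_of_le_one_right card_pos.le (sum_inv_two_mul_card_pow_length_le_one hI)
  rw [Finset.sum_sub_distrib, Finset.sum_const, nsmul_eq_mul, ← Finset.mul_sum] at sum_le
  linarith

section TransitivePerm

variable {α β κ : Type*} [Finite α] {π : Perm α} {ρ : Perm β} {a : α} {b : β}

theorem bijective_iterate (hπ : ∀ c, π.SameCycle a c) :
    Function.Bijective fun k : Fin (Function.minimalPeriod π a) => π^[k] a := by
  refine ⟨fun k l h =>
    Fin.ext ((Function.iterate_eq_iterate_iff_of_lt_minimalPeriod k.2 l.2).1 h), fun c => ?_⟩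
  obtain ⟨n, hn, rfl⟩ := exists_iterate_eq_of_sameCycle (hπ c)
  exact ⟨⟨n, hn⟩, rfl⟩

theorem minimalPeriod_eq_card (hπ : ∀ c, π.SameCycle a c) :
    Function.minimalPeriod π a = Nat.card α := by
  rw [← Nat.card_eq_of_bijective _ (bijective_iterate hπ), Nat.card_fin]

theorem exists_equiv_of_minimalPeriod_eq [Finite β] (hπ : ∀ c, π.SameCycle a c)
    (hρ : ∀ c, ρ.SameCycle b c)
    (h : Function.minimalPeriod π a = Function.minimalPeriod ρ b) :
    ∃ e : α ≃ β, ∀ k, e (π^[k] a) = ρ^[k] b := by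
  let f := Equiv.ofBijective _ (bijective_iterate hπ)
  let g := Equiv.ofBijective _ (bijective_iterate hρ)
  refine ⟨f.symm.trans ((finCongr h).trans g), fun k => ?_⟩
  have period_pos : 0 < Function.minimalPeriod π a :=
    Function.minimalPeriod_pos_of_mem_periodicPts (π.injective.mem_periodicPts a)
  have iterate_eq :
      π^[k] a = f ⟨k % Function.minimalPeriod π a, Nat.mod_lt k period_pos⟩ :=
    Function.iterate_mod_minimalPeriod_eq.symm
  rw [iterate_eq, trans_apply, symm_apply_apply]
  change ρ^[k % Function.minimalPeriod π a] b = _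
  rw [h, Function.iterate_mod_minimalPeriod_eq]

theorem exists_equiv_of_orbitWord_eq [Finite β] {l : α → κ} {m : β → κ}
    (hπ : ∀ c, π.SameCycle a c) (hρ : ∀ c, ρ.SameCycle b c)
    (h : orbitWord π l a = orbitWord ρ m b) :
    ∃ e : α ≃ β, (∀ c, e (π c) = ρ (e c)) ∧ ∀ c, m (e c) = l c := by
  obtain ⟨period_eq, letter_eq⟩ := orbitWord_eq_iff.1 h
  obtain ⟨e, he⟩ := exists_equiv_of_minimalPeriod_eq hπ hρ period_eq
  refine ⟨e, fun c => ?_, fun c => ?_⟩ <;>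
    obtain ⟨k, hk, rfl⟩ := exists_iterate_eq_of_sameCycle (hπ c)
  · rw [← Function.iterate_succ_apply' π, he, he, Function.iterate_succ_apply']
  · rw [he, letter_eq k hk]

end TransitivePerm

/-! ### The words along the level curves -/

namespace AnnularDiagram

open RotationSystem

variable {X : Type*} {R : Set (GroupWord X)} {Δ : AnnularDiagram R} {L i j n : ℕ}

/-- The alphabet of the level words: the contour of a cell read from the dart where a level curve
enters it, the number of steps along this contour to the dart where the curve leaves it, and the
level modulo `L + 1`. -/
abbrev Letter (R : Set (GroupWord X)) (L : ℕ) : Type _ := cellWords R × Fin L × ZMod (L + 1)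

section LevelWord

variable (hL : ∀ w ∈ cellWords R, w.length ≤ L) (hi : Δ.contour Δ.inner ⊆ (Δ.outerBall i)ᶜ)
  (hj : Δ.contour Δ.inner ⊆ (Δ.outerBall j)ᶜ)

/-- The letter at a dart crossed by the level curve of level `i`. -/
noncomputable def levelLetter (b : Δ.toRotationSystem.bond (Δ.innerSide i)) : Letter R L :=
  have face_ne := face_ne_of_mem_bond_innerSide hi b.2
  (⟨Δ.contourWord b.1, contourWord_mem_cellWords face_ne.1 face_ne.2⟩,
    ⟨Δ.toRotationSystem.run (Δ.innerSide i) b.1,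
      (run_lt b.2.1).trans_le (minimalPeriod_le hL face_ne.1 face_ne.2)⟩, i)

/-- The word read along the level curve of level `i`, the closed curve on the sphere that crosses
the edges between the inner side and its complement. The choice of the starting dart is
immaterial. -/
noncomputable def levelWord : List (Letter R L) :=
  orbitWord (innerSide_invariant i).turnPerm (levelLetter hL hi)
    ⟨_, (bond_innerSide_nonempty hi).some_mem⟩

theorem length_levelWord :
    (levelWord hL hi).length = Nat.card (Δ.toRotationSystem.bond (Δ.innerSide i)) :=
  length_orbitWord.trans (minimalPeriod_eq_card
    ((isCut_innerSide hi).turnPerm_sameCycle SphereMap.toRotationSystem_isPlanar _))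

theorem levelWord_ne_nil : levelWord hL hi ≠ [] := by
  have := (bond_innerSide_nonempty hi).to_subtype
  rw [← List.length_pos_iff, length_levelWord]
  exact Nat.card_pos

theorem nonempty_splice_of_levelWord_eq (hij : i < j)
    (h : levelWord hL hj = levelWord hL hi) :
    Nonempty (Δ.Splice (Δ.innerSide j) (Δ.innerSide i)) := by
  have planar : Δ.toRotationSystem.IsPlanar := SphereMap.toRotationSystem_isPlanar
  obtain ⟨e, turn_e, letter_e⟩ := exists_equiv_of_orbitWord_eq
    ((isCut_innerSide hj).turnPerm_sameCycle planar _)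
    ((isCut_innerSide hi).turnPerm_sameCycle planar _) h
  have word_e (b) : Δ.contourWord (e b).1 = Δ.contourWord b.1 :=
    congrArg (fun l => l.1.1) (letter_e b)
  have add_le : i + L ≤ j := by
    obtain ⟨b, hb⟩ := bond_innerSide_nonempty hj
    have level_eq : (i : ZMod (L + 1)) = j := congrArg (fun l => l.2.2) (letter_e ⟨b, hb⟩)
    have := ((ZMod.natCast_eq_natCast_iff i j (L + 1)).1 level_eq).add_le_of_lt hij
    omega
  exact ⟨{
    planar
    cut₁ := isCut_innerSide hj
    cut₂ := isCut_innerSide hi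
    subset := innerSide_anti hij.le
    nonempty := bond_innerSide_nonempty hj
    e
    turn_e
    run_e := fun b => congrArg (fun l => l.2.1.1) (letter_e b)
    period_e := fun b => (orbitWord_eq_iff.1 (word_e b)).1
    inner_mem := fun _ hd => contour_inner_subset_innerSide j hd
    outer_notMem := fun _ hd => notMem_innerSide_of_mem_contour hi hd
    separated := fun _ ha _ hb => face_ne_of_mem_innerSide_of_notMem_innerSide hj
      (fun _ => minimalPeriod_le hL) add_le ha hb
    contourWord_e := word_e }⟩

theorem levelWord_injective (hmin : Δ.IsMinimal ∨ Δ.IsMinimalProper)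
    (hn : ∀ k : Fin n, Δ.contour Δ.inner ⊆ (Δ.outerBall k)ᶜ) :
    Function.Injective fun k => levelWord hL (hn k) := by
  refine Function.Injective.of_lt_imp_ne fun k l hkl h => ?_
  obtain ⟨s⟩ := nonempty_splice_of_levelWord_eq hL (hn k) (hn l) hkl h.symm
  exact s.not_isMinimal hmin

theorem sum_length_levelWord_le (hn : ∀ k : Fin n, Δ.contour Δ.inner ⊆ (Δ.outerBall k)ᶜ) :
    ∑ k, (levelWord hL (hn k)).length ≤ L * Δ.area := by
  classical
  have disjoint : Pairwise (Function.onFun _root_.Disjoint fun k : Fin n =>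
      (Δ.toRotationSystem.bond (Δ.innerSide k)).toFinset) :=
    (pairwise_disjoint_on _).2 fun k l hkl =>
      Set.disjoint_toFinset.2 (disjoint_bond_innerSide (hn l) hkl)
  calc ∑ k, (levelWord hL (hn k)).length
      = ∑ k : Fin n, (Δ.toRotationSystem.bond (Δ.innerSide k)).toFinset.card := by
        simp only [length_levelWord, Nat.card_eq_fintype_card, Set.toFinset_card]
    _ = (Finset.univ.biUnion fun k : Fin n =>
          (Δ.toRotationSystem.bond (Δ.innerSide k)).toFinset).card :=
        (Finset.card_biUnion fun k _ l _ hkl => disjoint hkl).symm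
    _ ≤ L * Δ.area := card_le_mul_area hL _ fun d hd => by
        obtain ⟨k, -, hk⟩ := Finset.mem_biUnion.1 hd
        exact face_ne_of_mem_bond_innerSide (hn k) (Set.mem_toFinset.1 hk)

include hL in
theorem mul_log_le_log_mul_area [Fintype (Letter R L)]
    (hmin : Δ.IsMinimal ∨ Δ.IsMinimalProper)
    (hn : ∀ k : Fin n, Δ.contour Δ.inner ⊆ (Δ.outerBall k)ᶜ) :
    n * Real.log n ≤ Real.log (2 * Fintype.card (Letter R L) : ℕ) * (L * Δ.area : ℕ) := by
  let words : Finset (List (Letter R L)) :=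
    Finset.univ.map ⟨_, levelWord_injective hL hmin hn⟩
  have card_words : words.card = n := by rw [Finset.card_map, Finset.card_univ, Fintype.card_fin]
  have sum_length_words : ∑ w ∈ words, w.length ≤ L * Δ.area :=
    (Finset.sum_map _ _ _).trans_le (sum_length_levelWord_le hL hn)
  have nil_notMem : [] ∉ words := fun h => by
    obtain ⟨k, -, hk⟩ := Finset.mem_map.1 h
    exact levelWord_ne_nil hL (hn k) hk
  rw [← card_words]
  exact (card_mul_log_card_le_sum_length nil_notMem).trans
    (mul_le_mul_of_nonneg_left (mod_cast sum_length_words) (Real.log_natCast_nonneg _))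

end LevelWord

end AnnularDiagram

theorem mainTheorem6_general {X : Type*} (R : Set (GroupWord X)) (hR : R.Finite) :
    ∃ C : ℝ, 0 < C ∧
      ∀ Δ : AnnularDiagram R, Δ.IsMinimal ∨ Δ.IsMinimalProper →
        ∀ x : List Δ.Dart, Δ.IsShortestConnecting x →
          C * (x.length : ℝ) * Real.log (x.length : ℝ) ≤ (Δ.area : ℝ) := by
  have finite_cellWords := AnnularDiagram.finite_cellWords hR
  obtain ⟨L, hL⟩ := (finite_cellWords.image List.length).bddAbove
  replace hL : ∀ w ∈ AnnularDiagram.cellWords R, w.length ≤ L := fun w hw => hL ⟨w, hw, rfl⟩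
  have := finite_cellWords.to_subtype
  have := Fintype.ofFinite (AnnularDiagram.Letter R L)
  set K := Real.log (2 * Fintype.card (AnnularDiagram.Letter R L) : ℕ)
  have : 0 ≤ K := Real.log_natCast_nonneg _
  refine ⟨(K * L + 1)⁻¹, by positivity, fun Δ hmin x hx => ?_⟩
  rw [mul_assoc, inv_mul_le_iff₀ (by positivity)]
  calc x.length * Real.log x.length ≤ K * (L * Δ.area : ℕ) :=
        AnnularDiagram.mul_log_le_log_mul_area hL hmin fun k =>
          AnnularDiagram.contour_inner_subset_of_isShortestConnecting hx k.2
    _ = K * L * Δ.area := by rw [Nat.cast_mul, mul_assoc]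
    _ ≤ (K * L + 1) * Δ.area := by gcongr; exact le_add_of_nonneg_right zero_le_one

theorem mainTheorem6 {X : Type*} [Finite X] (R : Set (GroupWord X)) (hR : R.Finite) :
    ∃ C : ℝ, 0 < C ∧
      ∀ Δ : AnnularDiagram R, Δ.IsMinimal ∨ Δ.IsMinimalProper →
        ∀ x : List Δ.Dart, Δ.IsShortestConnecting x →
          C * (x.length : ℝ) * Real.log (x.length : ℝ) ≤ (Δ.area : ℝ) :=
  mainTheorem6_general R hR
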